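/- Let $n\ge 2$. For a vector field $u=(u_1,\dots,u_n)\in L^2(\mathbb R^n;\mathbb R^n)\cap L^\infty$ the associated pressure is $$p=\sum_{l,k=1}^n(-\Delta)^{-1}\partial_l\partial_k(u_lu_k),$$ that is, the function $p\in L^2(\mathbb R^n)$, unique up to a null set, with $\hat p(\xi)=-\sum_{l,k}\frac{\xi_l\xi_k}{|\xi|^2}\,\widehat{u_lu_k}(\xi)$. (a) There is a divergence-free (in the sense of distributions) vector field $u\in C^{1/2}(\mathbb R^n;\mathbb R^n)\cap L^2(\mathbb R^n;\mathbb R^n)$, i.e. $\|u\|_\infty+\sup_{x\ne y}\frac{|u(x)-u(y)|}{|x-y|^{1/2}}<\infty$ and $\|u\|_2<\infty$, whose pressure $p$ is not in $C^1$: $p$ does not agree almost everywhere with any continuously differentiable function on $\mathbb R^n$. (b) Let $\tilde\phi\in C_c^\infty(\mathbb R^n)$ be any real-valued function with $\tilde\phi(\xi)=1$ for $|\xi|\le1$ and $\tilde\phi(\xi)=0$ for $|\xi|>\frac76$; for $j\in\mathbb Z$ let $P_j$ be the Fourier multiplier with symbol $\tilde\phi(2^{-j}\xi)-\tilde\phi(2^{1-j}\xi)$,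 where $\hat f(\xi)=\int e^{-ix\cdot\xi}f(x)\,dx$, and let $\|u\|_{\dot B^{1/2}_{\infty,\infty}}=\sup_{j\in\mathbb Z}2^{j/2}\|P_ju\|_\infty$. Then for every $\varepsilon>0$ there is a divergence-free Schwartz vector field $u:\mathbb R^n\to\mathbb R^n$ with $$\|u\|_{\dot B^{1/2}_{\infty,\infty}}+\|u\|_2\le1$$ whose pressure $p$ is (after modification on a null set) smooth and satisfies $\|\nabla p\|_\infty>\frac1\varepsilon$. -/

import Mathlib

open MeasureTheory FourierTransform
open scoped ENNReal NNReal ContDiff SchwartzMap Gradient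

noncomputable section

/-- `ℝⁿ` with its Euclidean norm. -/
abbrev RSpace (n : ℕ) : Type := EuclideanSpace ℝ (Fin n)

/-- The pointwise divergence `∑ᵢ ∂ᵢ uᵢ` of a differentiable vector field. -/
def divergence {n : ℕ} (u : RSpace n → RSpace n) (x : RSpace n) : ℝ :=
  ∑ i : Fin n, (fderiv ℝ u x (EuclideanSpace.single i (1 : ℝ))) i

/-- `∇ · u = 0` in the sense of distributions: `∫ u · ∇ψ = 0` for all `ψ ∈ C_c^∞(ℝⁿ)`. -/
def WeaklyDivFree {n : ℕ} (u : RSpace n → RSpace n) : Prop :=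
  ∀ ψ : RSpace n → ℝ, ContDiff ℝ ∞ ψ → HasCompactSupport ψ →
    ∫ x, inner ℝ (u x) (∇ ψ x) = 0

/-- `u ∈ C^s`, `0 < s < 1`: `u` is bounded and (globally) Hölder continuous of exponent `s`,
that is, `‖u‖_∞ + sup_{x ≠ y} |u x - u y| / |x - y|^s < ∞`. -/
def BoundedHolder {n : ℕ} (s : ℝ≥0) (u : RSpace n → RSpace n) : Prop :=
  (∃ M : ℝ, ∀ x, ‖u x‖ ≤ M) ∧ MemHolder s u

/-- The Fourier transform of `∑_{l,k} (-Δ)⁻¹ ∂_l ∂_k (u_l u_k)`, i.e.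
`ξ ↦ ∑_{l,k} |ξ|⁻² (iξ_l) (iξ_k) (u_l u_k)^(ξ)`. The multiplier is homogeneous of degree `0`, so it
does not depend on the factor `2π` in the normalization of the Fourier transform.
For `u ∈ L²` the products `u_l u_k` are integrable. -/
def pressureSymbol {n : ℕ} (u : RSpace n → RSpace n) (ξ : RSpace n) : ℂ :=
  ∑ l : Fin n, ∑ k : Fin n,
    ((-(ξ l * ξ k) / ‖ξ‖ ^ 2 : ℝ) : ℂ) * 𝓕 (fun x : RSpace n => ((u x l * u x k : ℝ) : ℂ)) ξ

/-- `p` is the pressure `∑_{l,k} (-Δ)⁻¹ ∂_l ∂_k (u_l u_k)` of `u ∈ L² ∩ L^∞`: the function `p ∈ L²`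
whose Fourier transform, in the sense of tempered distributions, is `pressureSymbol u`.
It determines `p` up to a set of measure zero. -/
def IsPressure {n : ℕ} (u : RSpace n → RSpace n) (p : RSpace n → ℝ) : Prop :=
  MemLp p 2 volume ∧
    ∀ ψ : 𝓢(RSpace n, ℂ), ∫ x, (p x : ℂ) * 𝓕 (ψ : RSpace n → ℂ) x = ∫ ξ, pressureSymbol u ξ * ψ ξ

/-- The cut-off functions from which Littlewood-Paley projections are built: `φ ∈ C_c^∞(ℝⁿ)`,
`φ = 1` for `|ξ| ≤ 1` and `φ = 0` for `|ξ| > 7/6`. -/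
structure IsLPCutoff {n : ℕ} (φ : RSpace n → ℝ) : Prop where
  smooth : ContDiff ℝ ∞ φ
  eq_one : ∀ ξ, ‖ξ‖ ≤ 1 → φ ξ = 1
  eq_zero : ∀ ξ, 7 / 6 < ‖ξ‖ → φ ξ = 0

/-- A real vector field as a complex one, so that its Fourier transform makes sense. -/
def complexify {n : ℕ} (u : RSpace n → RSpace n) (x : RSpace n) : EuclideanSpace ℂ (Fin n) :=
  WithLp.toLp 2 fun i => (u x i : ℂ)

/-- The Littlewood-Paley projection `P_j`: the Fourier multiplier with symbol
`φ(2^{-j} ξ) - φ(2^{-j+1} ξ)`, where `ξ` is the frequency variable for the convention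
`f^(ξ) = ∫ e^{-i x·ξ} f(x) dx`. Mathlib's `𝓕` uses `e^{-2πi x·ξ}` instead; so the symbol is
evaluated at `2πξ`. -/
def lpProj {n : ℕ} (φ : RSpace n → ℝ) (j : ℤ) (u : RSpace n → RSpace n) :
    RSpace n → EuclideanSpace ℂ (Fin n) :=
  𝓕⁻ fun ξ : RSpace n =>
    (φ (((2 : ℝ) ^ (-j) * (2 * Real.pi)) • ξ) - φ ((2 * ((2 : ℝ) ^ (-j) * (2 * Real.pi))) • ξ)) •
      𝓕 (complexify u) ξ

/-- The homogeneous Besov norm `‖u‖_{Ḃ^s_{∞,∞}} = sup_j 2^{js} ‖P_j u‖_∞`. -/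
def besovNorm {n : ℕ} (φ : RSpace n → ℝ) (s : ℝ) (u : RSpace n → RSpace n) : ℝ≥0∞ :=
  ⨆ j : ℤ, ENNReal.ofReal ((2 : ℝ) ^ ((j : ℝ) * s)) * eLpNorm (lpProj φ j u) ∞ volume

end

/-! Since -Δp = ∑ ∂_l∂_k(u_l u_k), the derivative ∂_i p(0) is, up to a constant, the integral of u_l
u_k against the second derivatives of the dipole x_i/|x|^n. That kernel is homogeneous of degree
-n-1, and a field of Hölder exponent 1/2 vanishing at 0 only gives |u|² = O(|x|), so each dyadic
annulus may contribute an amount of the same size. The construction makes all these contributions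
equal and positive, so that they add up to a logarithmic divergence.

The field is a superposition of pieces 2^{-j/2} U(2^j x), where U is smooth, divergence-free and
supported in 3/4 < |x| < 5/4. The supports are disjoint, so u_l u_k has no cross terms, and the
scaling preserves the Hölder-1/2 constant (`norm_cascade_sub_le`). The profile comes from a rapidly
oscillating stream function and satisfies Q = ∫ D²k(U,U) > 0 (`exists_stream_field`).

To avoid evaluating p at a point, the dipole is smoothed near 0 to a function k with Δk = ∂_i K, K
compactly supported (`exists_dipole`). By homogeneity k_c = c^{n-1} k(c·) - k has compact support,
and Δk_c = ∂_i(c^n K(c·) - K), a derivative of a function with L¹ norm at most 2‖K‖₁ for every c. If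
|∂_i p| ≤ M on the unit ball, the weak pressure equation gives |∫ D²k_c(u,u)| ≤ 2M‖K‖₁
(`IsPressure.abs_integral_hess_dilationDiff_le`). For c = 2^J the same integral equals J·Q on the
cascade (`integral_hess_dilationDiff_cascade`, `integral_hess_dilationDiff_fullCascade`).

For (a), the infinite cascade makes J arbitrary with M fixed. For (b), a finite cascade is
multiplied by a constant independent of J; the Besov norm is bounded by the Hölder seminorm
(`besovNorm_le_of_holder`), and J is then taken large. -/

noncomputable section

/-! ### Fourier transforms on L¹ ∩ L² and reality of the inverse transform -/

/-- Functions in `L^p`, `1 ≤ p`, are determined by their integrals against Fourier transforms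
of Schwartz functions. -/
theorem ae_eq_of_integral_mul_fourier_eq {n : ℕ} {f g : RSpace n → ℂ}
    (hf : LocallyIntegrable f volume) (hg : LocallyIntegrable g volume)
    (h : ∀ ψ : 𝓢(RSpace n, ℂ), ∫ x, f x * 𝓕 (ψ : RSpace n → ℂ) x
      = ∫ x, g x * 𝓕 (ψ : RSpace n → ℂ) x) : f =ᵐ[volume] g := by
  refine ae_eq_of_integral_contDiff_smul_eq hf hg fun η hη hηc => ?_
  have h1 : HasCompactSupport (Complex.ofRealCLM ∘ η) := hηc.comp_left rfl
  have h2 : ContDiff ℝ ∞ (Complex.ofRealCLM ∘ η) := by fun_prop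
  have := h (𝓕⁻ (h1.toSchwartzMap h2))
  rw [← SchwartzMap.fourier_coe, fourier_fourierInv_eq] at this
  simpa [mul_comm, Complex.real_smul] using this

theorem integral_fourier_mul_eq {n : ℕ} {f g : RSpace n → ℂ} (hf : Integrable f)
    (hg : Integrable g) : ∫ x, 𝓕 f x * g x = ∫ x, f x * 𝓕 g x := by
  have := VectorFourier.integral_fourierIntegral_smul_eq_flip (μ := (volume : Measure (RSpace n)))
    (ν := (volume : Measure (RSpace n))) (L := innerₗ (RSpace n))
    (f := f) (g := g) Real.continuous_fourierChar continuous_inner hf hg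
  rw [flip_innerₗ] at this
  exact this

/-- By testing against `𝓕 ψ`, the integral transform is identified with the Plancherel extension,
whose values lie in L² by construction. -/
theorem memLp_fourier {n : ℕ} {f : RSpace n → ℂ} (hf : Integrable f) (hf2 : MemLp f 2 volume) :
    MemLp (𝓕 f) 2 volume := by
  have hcont : Continuous (𝓕 f) :=
    VectorFourier.fourierIntegral_continuous Real.continuous_fourierChar continuous_inner hf
  have hae : 𝓕 f =ᵐ[volume] (𝓕 (hf2.toLp f) : Lp (α := RSpace n) ℂ 2 volume) := by
    refine ae_eq_of_integral_mul_fourier_eq hcont.locallyIntegrable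
      ((Lp.memLp (μ := volume) _).locallyIntegrable (by norm_num)) fun ψ => ?_
    have h1 := congrArg (fun T => T (𝓕 ψ)) (Lp.fourier_toTemperedDistribution_eq (hf2.toLp f))
    simp only [TemperedDistribution.fourier_apply, Lp.toTemperedDistribution_apply,
      smul_eq_mul] at h1
    rw [← SchwartzMap.fourier_coe, integral_fourier_mul_eq hf ((𝓕 ψ).integrable (μ := volume))]
    simp_rw [mul_comm _ (𝓕 ψ _)]
    rw [← h1]
    refine integral_congr_ae ?_
    filter_upwards [hf2.coeFn_toLp] with x hx
    rw [hx, SchwartzMap.fourier_coe (𝓕 ψ), mul_comm]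
  exact (memLp_congr_ae hae).2 (Lp.memLp _)

/-- A function in `L²` is the Fourier transform, in the sense of tempered distributions, of a
function in `L²`. -/
theorem exists_memLp_fourier_eq {n : ℕ} {m : RSpace n → ℂ} (hm : MemLp m 2 volume) :
    ∃ p : RSpace n → ℂ, MemLp p 2 volume ∧
      ∀ ψ : 𝓢(RSpace n, ℂ), ∫ x, p x * 𝓕 (ψ : RSpace n → ℂ) x = ∫ ξ, m ξ * ψ ξ := by
  refine ⟨(𝓕⁻ (hm.toLp m) : Lp (α := RSpace n) ℂ 2 volume), Lp.memLp _, fun ψ => ?_⟩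
  have h1 := congrArg (fun T => T (𝓕 ψ)) (Lp.fourierInv_toTemperedDistribution_eq (hm.toLp m))
  simp only [TemperedDistribution.fourierInv_apply, Lp.toTemperedDistribution_apply,
      smul_eq_mul, fourierInv_fourier_eq] at h1
  rw [← SchwartzMap.fourier_coe]
  simp_rw [mul_comm _ (𝓕 ψ _)]
  rw [← h1]
  refine integral_congr_ae ?_
  filter_upwards [hm.coeFn_toLp] with x hx
  rw [hx, mul_comm]

theorem conj_fourier {n : ℕ} (f : RSpace n → ℂ) (ξ : RSpace n) :
    (starRingEnd ℂ) (𝓕 f ξ) = 𝓕 (fun x => (starRingEnd ℂ) (f x)) (-ξ) := by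
  rw [Real.fourier_eq', Real.fourier_eq', ← integral_conj]
  refine integral_congr_ae (.of_forall fun x => ?_)
  simp [← Complex.exp_conj, Complex.conj_ofReal, map_ofNat]

/-- Hermitian symmetry of `m` makes the conjugate of a solution `p` a solution too, so their
average, the real part, is one. -/
theorem exists_real_memLp_fourier_eq {n : ℕ} {m : RSpace n → ℂ} (hm : MemLp m 2 volume)
    (hsymm : ∀ ξ, (starRingEnd ℂ) (m (-ξ)) = m ξ) :
    ∃ p : RSpace n → ℝ, MemLp p 2 volume ∧
      ∀ ψ : 𝓢(RSpace n, ℂ), ∫ x, (p x : ℂ) * 𝓕 (ψ : RSpace n → ℂ) x = ∫ ξ, m ξ * ψ ξ := by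
  obtain ⟨p, hp, hpm⟩ := exists_memLp_fourier_eq hm
  refine ⟨fun x => (p x).re, hp.re, fun ψ => ?_⟩
  -- The reflection-conjugate of `ψ`, whose Fourier transform is the conjugate of `𝓕 ψ`.
  let ψ' : 𝓢(RSpace n, ℂ) := SchwartzMap.compCLMOfContinuousLinearEquiv ℝ
    (ContinuousLinearEquiv.neg ℝ) (ψ.postcompCLM (Complex.conjCLE : ℂ →L[ℝ] ℂ))
  have hψ' : ∀ x, ψ' x = (starRingEnd ℂ) (ψ (-x)) := fun x => by simp [ψ']
  have hF : ∀ x, 𝓕 (ψ' : RSpace n → ℂ) x = (starRingEnd ℂ) (𝓕 (ψ : RSpace n → ℂ) x) := by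
    intro x
    rw [conj_fourier, Real.fourier_eq', Real.fourier_eq', ← integral_neg_eq_self]
    simp [hψ']
  have h2 : ∫ x, (starRingEnd ℂ) (p x) * 𝓕 (ψ : RSpace n → ℂ) x = ∫ ξ, m ξ * ψ ξ := by
    have := congrArg (starRingEnd ℂ) (hpm ψ')
    rw [← integral_conj, ← integral_conj,
      ← integral_neg_eq_self (fun ξ => (starRingEnd ℂ) (m ξ * ψ' ξ))] at this
    simpa only [hF, hψ', hsymm, map_mul, Complex.conj_conj, neg_neg] using this
  have hint : Integrable (fun x => p x * 𝓕 (ψ : RSpace n → ℂ) x) :=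
    hp.integrable_mul ((𝓕 ψ).memLp 2 volume)
  have hint' : Integrable (fun x => (starRingEnd ℂ) (p x) * 𝓕 (ψ : RSpace n → ℂ) x) :=
    hp.star.integrable_mul ((𝓕 ψ).memLp 2 volume)
  have : ∀ x, ((p x).re : ℂ) * 𝓕 (ψ : RSpace n → ℂ) x = (1 / 2 : ℂ) *
      (p x * 𝓕 (ψ : RSpace n → ℂ) x + (starRingEnd ℂ) (p x) * 𝓕 (ψ : RSpace n → ℂ) x) := by
    intro x
    rw [← add_mul, Complex.add_conj]
    push_cast; ring
  simp only [this]
  rw [integral_const_mul, integral_add hint hint', hpm, h2]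
  ring

/-! ### Existence and smoothness of the pressure -/

theorem norm_pressureSymbol_le {n : ℕ} (u : RSpace n → RSpace n) (ξ : RSpace n) :
    ‖pressureSymbol u ξ‖ ≤
      ∑ l : Fin n, ∑ k : Fin n, ‖𝓕 (fun x : RSpace n => ((u x l * u x k : ℝ) : ℂ)) ξ‖ := by
  refine (norm_sum_le _ _).trans (Finset.sum_le_sum fun l _ => (norm_sum_le _ _).trans
    (Finset.sum_le_sum fun k _ => ?_))
  rw [norm_mul]
  refine mul_le_of_le_one_left (norm_nonneg _) ?_
  rw [Complex.norm_real, norm_div, norm_neg, norm_mul, norm_pow, norm_norm]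
  refine div_le_one_of_le₀ ?_ (by positivity)
  rw [sq]
  gcongr <;> exact PiLp.norm_apply_le ξ _

theorem conj_pressureSymbol_neg {n : ℕ} (u : RSpace n → RSpace n) (ξ : RSpace n) :
    (starRingEnd ℂ) (pressureSymbol u (-ξ)) = pressureSymbol u ξ := by
  simp only [pressureSymbol, map_sum, map_mul, conj_fourier, Complex.conj_ofReal, neg_neg]
  simp

section Products

variable {n : ℕ} {u : RSpace n → RSpace n}

theorem memLp_component (hu : MemLp u 2 volume) (l : Fin n) :
    MemLp (fun x => u x l) 2 volume :=
  (EuclideanSpace.proj (𝕜 := ℝ) l).comp_memLp' hu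

theorem integrable_component_mul (hu : MemLp u 2 volume) (l k : Fin n) :
    Integrable (fun x => ((u x l * u x k : ℝ) : ℂ)) :=
  ((memLp_component hu l).integrable_mul (memLp_component hu k)).ofReal

theorem memLp_component_mul (hu : MemLp u 2 volume) {M : ℝ} (hM : ∀ x, ‖u x‖ ≤ M) (l k : Fin n) :
    MemLp (fun x => ((u x l * u x k : ℝ) : ℂ)) 2 volume := by
  have h := ((memLp_component hu k).const_mul M)
  refine h.of_le (integrable_component_mul hu l k).aestronglyMeasurable (.of_forall fun x => ?_)
  rw [Complex.norm_real, norm_mul, norm_mul]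
  gcongr
  exact ((PiLp.norm_apply_le _ _).trans (hM x)).trans (le_abs_self M)

theorem continuous_fourier_component_mul (hu : MemLp u 2 volume) (l k : Fin n) :
    Continuous (𝓕 (fun x => ((u x l * u x k : ℝ) : ℂ))) :=
  VectorFourier.fourierIntegral_continuous Real.continuous_fourierChar continuous_inner
    (integrable_component_mul hu l k)

theorem measurable_pressureSymbol (hu : MemLp u 2 volume) : Measurable (pressureSymbol u) := by
  unfold pressureSymbol
  have := fun l k => (continuous_fourier_component_mul hu l k).measurable
  fun_prop

theorem exists_isPressure (hu : MemLp u 2 volume) {M : ℝ} (hM : ∀ x, ‖u x‖ ≤ M) :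
    ∃ p : RSpace n → ℝ, IsPressure u p := by
  refine exists_real_memLp_fourier_eq ?_ (conj_pressureSymbol_neg u)
  have h : MemLp (fun ξ => ∑ l : Fin n, ∑ k : Fin n,
      ‖𝓕 (fun x : RSpace n => ((u x l * u x k : ℝ) : ℂ)) ξ‖) 2 volume :=
    memLp_finsetSum _ fun l _ => memLp_finsetSum _ fun k _ =>
      (memLp_fourier (integrable_component_mul hu l k) (memLp_component_mul hu hM l k)).norm
  refine h.of_le (measurable_pressureSymbol hu).aestronglyMeasurable (.of_forall fun ξ => ?_)
  exact (norm_pressureSymbol_le u ξ).trans (le_abs_self _)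

end Products

theorem IsPressure.congr_ae {n : ℕ} {u : RSpace n → RSpace n} {p q : RSpace n → ℝ}
    (hp : IsPressure u p) (h : p =ᵐ[volume] q) : IsPressure u q := by
  refine ⟨(memLp_congr_ae h).1 hp.1, fun ψ => ?_⟩
  rw [← hp.2 ψ]
  refine integral_congr_ae ?_
  filter_upwards [h] with x hx
  rw [hx]

/-- The pressure of a smooth compactly supported field has a smooth representative. -/
theorem exists_isPressure_contDiff {n : ℕ} {u : RSpace n → RSpace n} (hu : ContDiff ℝ ∞ u)
    (hc : HasCompactSupport u) : ∃ p : RSpace n → ℝ, IsPressure u p ∧ ContDiff ℝ ∞ p := by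
  have hu2 : MemLp u 2 volume := hu.continuous.memLp_of_hasCompactSupport hc
  obtain ⟨M, hM⟩ := hu.continuous.bounded_above_of_compact_support hc
  obtain ⟨p, hp⟩ := exists_isPressure hu2 hM
  have hS : ∀ l k : Fin n, ∃ S : 𝓢(RSpace n, ℂ),
      (S : RSpace n → ℂ) = fun x => ((u x l * u x k : ℝ) : ℂ) := by
    intro l k
    have h1 : HasCompactSupport (fun x => ((u x l * u x k : ℝ) : ℂ)) :=
      hc.comp_left (g := fun v : RSpace n => ((v l * v k : ℝ) : ℂ)) (by simp)
    have h2 : ContDiff ℝ ∞ (fun x => ((u x l * u x k : ℝ) : ℂ)) := by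
      have h3 : ∀ i, ContDiff ℝ ∞ (fun x => u x i) := fun i =>
        (EuclideanSpace.proj (𝕜 := ℝ) i).contDiff.comp hu
      exact Complex.ofRealCLM.contDiff.comp ((h3 l).mul (h3 k))
    exact ⟨h1.toSchwartzMap h2, rfl⟩
  choose S hS using hS
  -- The multiplier is bounded but singular at the origin: the symbol need not be Schwartz, yet all
  -- its moments are finite, which is enough for a smooth inverse transform.
  have hdecay : ∀ N : ℕ, Integrable (fun ξ => ‖ξ‖ ^ N * ‖pressureSymbol u ξ‖) := by
    intro N
    have h : Integrable (fun ξ => ∑ l : Fin n, ∑ k : Fin n,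
        ‖ξ‖ ^ N * ‖𝓕 (fun x : RSpace n => ((u x l * u x k : ℝ) : ℂ)) ξ‖) := by
      refine integrable_finsetSum _ fun l _ => integrable_finsetSum _ fun k _ => ?_
      rw [← hS l k]
      exact (𝓕 (S l k)).integrable_pow_mul volume N
    refine h.mono' (by have := measurable_pressureSymbol hu2; fun_prop) (.of_forall fun ξ => ?_)
    rw [norm_mul, norm_pow, norm_norm, norm_norm]
    refine (mul_le_mul_of_nonneg_left (norm_pressureSymbol_le u ξ) (by positivity)).trans_eq ?_
    simp only [Finset.mul_sum]
  have hint : Integrable (pressureSymbol u) := by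
    have := hdecay 0
    simp only [pow_zero, one_mul] at this
    exact (integrable_norm_iff (measurable_pressureSymbol hu2).aestronglyMeasurable).1 this
  have hsm : ContDiff ℝ ∞ (𝓕⁻ (pressureSymbol u)) := by
    rw [show 𝓕⁻ (pressureSymbol u) = fun x => 𝓕 (pressureSymbol u) (-x) from
      funext fun x => Real.fourierInv_eq_fourier_neg _ _]
    exact (Real.contDiff_fourier (N := ⊤) fun N _ => hdecay N).comp contDiff_neg
  have hae : (fun x => (p x : ℂ)) =ᵐ[volume] 𝓕⁻ (pressureSymbol u) := by
    refine ae_eq_of_integral_mul_fourier_eq ?_ hsm.continuous.locallyIntegrable fun ψ => ?_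
    · exact (hp.1.ofReal (K := ℂ)).locallyIntegrable (by norm_num)
    · rw [hp.2 ψ, Real.fourierInv_eq_fourier_comp_neg]
      rw [← SchwartzMap.fourier_coe, integral_fourier_mul_eq (hint.comp_neg) ((𝓕 ψ).integrable (μ := volume)),
        ← integral_neg_eq_self]
      refine integral_congr_ae (.of_forall fun ξ => ?_)
      have hψ : ∀ ξ, ψ ξ = 𝓕 ((𝓕 ψ : 𝓢(RSpace n, ℂ)) : RSpace n → ℂ) (-ξ) := fun ξ => by
        rw [← Real.fourierInv_eq_fourier_neg, ← SchwartzMap.fourierInv_coe,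
          fourierInv_fourier_eq (F := 𝓢(RSpace n, ℂ)) ψ]
      simp only [hψ (-ξ), neg_neg]
  refine ⟨fun x => (𝓕⁻ (pressureSymbol u) x).re, hp.congr_ae ?_, Complex.reCLM.contDiff.comp hsm⟩
  filter_upwards [hae] with x hx
  rw [← hx, Complex.ofReal_re]

/-! ### Second derivatives and the weak pressure equation -/

/-- The coordinate vector `e_i` of `ℝⁿ`. -/
abbrev stdVec {n : ℕ} (i : Fin n) : RSpace n := EuclideanSpace.single i (1 : ℝ)

/-- The second derivative of `h` at `x` as a bilinear form. -/
abbrev hess {n : ℕ} (h : RSpace n → ℝ) (x : RSpace n) : RSpace n →L[ℝ] RSpace n →L[ℝ] ℝ :=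
  fderiv ℝ (fderiv ℝ h) x

theorem eq_sum_stdVec {n : ℕ} (v : RSpace n) : v = ∑ i, v i • stdVec i := by
  ext j
  simp [Finset.sum_apply, Pi.single_apply]

theorem bilin_eq_sum {n : ℕ} (B : RSpace n →L[ℝ] RSpace n →L[ℝ] ℝ) (v w : RSpace n) :
    B v w = ∑ l, ∑ k, v l * w k * B (stdVec l) (stdVec k) := by
  conv_lhs => rw [eq_sum_stdVec v, eq_sum_stdVec w]
  simp only [map_sum, map_smul, sum_apply, smul_apply,
    smul_eq_mul, Finset.mul_sum, mul_assoc]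
  rw [Finset.sum_comm]
  refine Finset.sum_congr rfl fun l _ => Finset.sum_congr rfl fun k _ => by ring

theorem fourierInv_lineDeriv_lineDeriv {n : ℕ} (H : 𝓢(RSpace n, ℂ)) (v w : RSpace n)
    (ξ : RSpace n) : 𝓕⁻ (LineDeriv.lineDerivOp v (LineDeriv.lineDerivOp w H)) ξ =
      (-((2 * Real.pi) ^ 2 * (inner ℝ ξ v * inner ℝ ξ w)) : ℝ) * 𝓕⁻ H ξ := by
  have hg : ∀ m : RSpace n, (inner ℝ · m : RSpace n → ℝ).HasTemperateGrowth := fun m =>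
    ((innerSL ℝ).flip m).hasTemperateGrowth
  rw [SchwartzMap.fourierInv_lineDerivOp_eq, SchwartzMap.fourierInv_lineDerivOp_eq]
  simp only [smul_apply, SchwartzMap.smulLeftCLM_apply_apply (hg _), Complex.real_smul,
    smul_eq_mul]
  push_cast
  linear_combination (4 * Real.pi ^ 2 * (inner ℝ ξ v : ℂ) * (inner ℝ ξ w : ℂ) * 𝓕⁻ H ξ : ℂ)
    * Complex.I_sq

theorem lineDeriv_lineDeriv_ofReal {n : ℕ} {h : RSpace n → ℝ} (hh : ContDiff ℝ ∞ h)
    {H : 𝓢(RSpace n, ℂ)} (hH : ∀ x, H x = h x) (v w x : RSpace n) :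
    LineDeriv.lineDerivOp v (LineDeriv.lineDerivOp w H) x = (hess h x v w : ℝ) := by
  have h1 : ∀ y, LineDeriv.lineDerivOp w H y = (fderiv ℝ h y w : ℝ) := fun y => by
    rw [SchwartzMap.lineDerivOp_apply_eq_fderiv, show (H : RSpace n → ℂ) = Complex.ofRealCLM ∘ h
      from funext hH, fderiv_comp _ Complex.ofRealCLM.differentiableAt
      (hh.differentiable (by simp)).differentiableAt, ContinuousLinearMap.fderiv]
    rfl
  have h2 : ContDiff ℝ ∞ (fderiv ℝ h) := hh.fderiv_right (by simp)
  rw [SchwartzMap.lineDerivOp_apply_eq_fderiv, show (LineDeriv.lineDerivOp w H : RSpace n → ℂ)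
    = Complex.ofRealCLM ∘ fun y => fderiv ℝ h y w from funext h1, fderiv_comp _
    Complex.ofRealCLM.differentiableAt
    ((h2.differentiable (by simp)).differentiableAt.clm_apply (differentiableAt_const w)),
    ContinuousLinearMap.fderiv,
    fderiv_clm_apply (h2.differentiable (by simp)).differentiableAt (differentiableAt_const w)]
  simp

/-- The weak form of `-Δ p = ∑ ∂_l ∂_k (u_l u_k)`. -/
theorem IsPressure.integral_mul_laplacian {n : ℕ} {u : RSpace n → RSpace n} {p : RSpace n → ℝ}
    (hp : IsPressure u p) (hu : MemLp u 2 volume) {h : RSpace n → ℝ} (hh : ContDiff ℝ ∞ h)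
    (hc : HasCompactSupport h) :
    ∫ x, p x * ∑ i, hess h x (stdVec i) (stdVec i) = - ∫ x, hess h x (u x) (u x) := by
  have h1 : HasCompactSupport (Complex.ofRealCLM ∘ h) := hc.comp_left rfl
  have h2 : ContDiff ℝ ∞ (Complex.ofRealCLM ∘ h) := by fun_prop
  let H : 𝓢(RSpace n, ℂ) := h1.toSchwartzMap h2
  have hH : ∀ x, H x = h x := fun x => rfl
  let D : Fin n → Fin n → 𝓢(RSpace n, ℂ) := fun l k =>
    LineDeriv.lineDerivOp (stdVec l) (LineDeriv.lineDerivOp (stdVec k) H)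
  have hD : ∀ l k x, D l k x = (hess h x (stdVec l) (stdVec k) : ℝ) := fun l k x =>
    lineDeriv_lineDeriv_ofReal hh hH _ _ x
  have hF : ∀ l k ξ, 𝓕⁻ (D l k) ξ = (-((2 * Real.pi) ^ 2 * (ξ l * ξ k)) : ℝ) * 𝓕⁻ H ξ := by
    intro l k ξ
    have := fourierInv_lineDeriv_lineDeriv H (stdVec l) (stdVec k) ξ
    simpa [EuclideanSpace.inner_single_right] using this
  -- Testing with the inverse transform of Δh brings in the factor |ξ|², which cancels the
  -- denominator of the pressure symbol.
  have key := hp.2 (𝓕⁻ (∑ i, D i i))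
  rw [← SchwartzMap.fourier_coe, fourier_fourierInv_eq] at key
  have hsym : ∀ ξ, pressureSymbol u ξ * 𝓕⁻ (∑ i, D i i) ξ =
      -∑ l, ∑ k, 𝓕 (fun x : RSpace n => ((u x l * u x k : ℝ) : ℂ)) ξ * 𝓕⁻ (D l k) ξ := by
    intro ξ
    have hlap : 𝓕⁻ (∑ i, D i i) ξ = (-((2 * Real.pi) ^ 2 * ‖ξ‖ ^ 2) : ℝ) * 𝓕⁻ H ξ := by
      rw [FourierTransform.fourierInv_sum, sum_apply]
      simp only [hF]
      rw [← Finset.sum_mul, ← Complex.ofReal_sum, EuclideanSpace.real_norm_sq_eq, Finset.mul_sum,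
        ← Finset.sum_neg_distrib]
      simp only [sq]
    rw [hlap, pressureSymbol, Finset.sum_mul, ← Finset.sum_neg_distrib]
    refine Finset.sum_congr rfl fun l _ => ?_
    rw [Finset.sum_mul, ← Finset.sum_neg_distrib]
    refine Finset.sum_congr rfl fun k _ => ?_
    rw [hF]
    -- At ξ = 0 the numerators ξ_l ξ_k vanish, so both sides are 0.
    rcases eq_or_ne ξ 0 with rfl | hξ
    · simp
    · have : (‖ξ‖ : ℂ) ≠ 0 := by simpa using hξ
      push_cast
      field_simp
  simp only [hsym] at key
  have hint : ∀ l k, Integrable (fun ξ =>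
      𝓕 (fun x : RSpace n => ((u x l * u x k : ℝ) : ℂ)) ξ * 𝓕⁻ (D l k) ξ) := by
    intro l k
    refine ((𝓕⁻ (D l k)).integrable (μ := volume)).bdd_mul
      (c := ∫ x, ‖((u x l * u x k : ℝ) : ℂ)‖)
      (continuous_fourier_component_mul hu l k).aestronglyMeasurable (.of_forall fun ξ => ?_)
    exact VectorFourier.norm_fourierIntegral_le_integral_norm _ _ _ _ _
  have hint2 : ∀ l k, Integrable (fun x => ((u x l * u x k : ℝ) : ℂ) * D l k x) := by
    intro l k
    exact (integrable_component_mul hu l k).mul_bdd (D l k).continuous.aestronglyMeasurable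
      (.of_forall fun ξ => SchwartzMap.norm_le_seminorm ℝ (D l k) ξ)
  have hflip : ∀ l k, ∫ ξ, 𝓕 (fun x : RSpace n => ((u x l * u x k : ℝ) : ℂ)) ξ * 𝓕⁻ (D l k) ξ =
      ∫ x, ((u x l * u x k : ℝ) : ℂ) * D l k x := by
    intro l k
    rw [integral_fourier_mul_eq (integrable_component_mul hu l k)
      ((𝓕⁻ (D l k)).integrable (μ := volume)), ← SchwartzMap.fourier_coe, fourier_fourierInv_eq]
  rw [integral_neg, integral_finsetSum _ fun l _ => integrable_finsetSum _ fun k _ => hint l k]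
    at key
  simp only [integral_finsetSum _ fun k _ => hint _ k, hflip] at key
  simp only [← integral_finsetSum _ fun k _ => hint2 _ k] at key
  rw [← integral_finsetSum _ fun l _ => integrable_finsetSum _ fun k _ => hint2 l k] at key
  have e1 : ∀ x, ∑ l, ∑ k, ((u x l * u x k : ℝ) : ℂ) * D l k x
      = (hess h x (u x) (u x) : ℝ) := by
    intro x
    rw [bilin_eq_sum (hess h x)]
    simp only [hD]
    push_cast
    rfl
  have e2 : ∀ x, (p x : ℂ) * (∑ i, D i i) x =
      ((p x * ∑ i, hess h x (stdVec i) (stdVec i) : ℝ) : ℂ) := by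
    intro x
    rw [sum_apply]
    simp only [hD]
    push_cast
    rfl
  simp only [e1, e2, integral_complex_ofReal] at key
  exact_mod_cast key

/-! ### Littlewood-Paley projections of Hölder fields -/

theorem norm_complexify {n : ℕ} (v : RSpace n → RSpace n) (x y : RSpace n) :
    ‖complexify v x - complexify v y‖ = ‖v x - v y‖ := by
  rw [EuclideanSpace.norm_eq, EuclideanSpace.norm_eq]
  congr 1
  refine Finset.sum_congr rfl fun i _ => ?_
  have : (complexify v x - complexify v y) i = ((v x - v y) i : ℝ) := by
    simp [complexify]
  rw [this, Complex.norm_real]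

theorem integrable_complexify {n : ℕ} {v : RSpace n → RSpace n} (hv : Integrable v) :
    Integrable (complexify v) := by
  refine Integrable.of_eval_piLp fun i => ?_
  exact ((EuclideanSpace.proj (𝕜 := ℝ) i).integrable_comp hv).ofReal

section Kernel

variable {n : ℕ} {F : Type*} [NormedAddCommGroup F] [NormedSpace ℂ F] [CompleteSpace F]

/-- A Fourier multiplier is the convolution with its kernel. -/
theorem fourierInv_smul_fourier {m : RSpace n → ℂ} (hm : Integrable m) {f : RSpace n → F}
    (hf : Integrable f) (x : RSpace n) :
    𝓕⁻ (fun ξ => m ξ • 𝓕 f ξ) x = ∫ z, 𝓕 m z • f (x + z) := by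
  let g : RSpace n → ℂ := fun ξ => Real.fourierChar (inner ℝ ξ x) • m ξ
  have hg : Integrable g := by
    have := (Real.fourierIntegral_convergent_iff (-x)).2 hm
    simpa [g] using this
  have hgF : ∀ y, 𝓕 g y = 𝓕 m (y - x) := by
    intro y
    rw [Real.fourier_eq, Real.fourier_eq]
    refine integral_congr_ae (.of_forall fun ξ => ?_)
    simp only [g]
    rw [smul_smul, ← AddChar.map_add_eq_mul]
    congr 2
    rw [inner_sub_right]; ring
  have h := VectorFourier.integral_fourierIntegral_smul_eq_flip
    (μ := (volume : Measure (RSpace n))) (ν := (volume : Measure (RSpace n)))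
    (L := innerₗ (RSpace n)) (f := g) (g := f) Real.continuous_fourierChar continuous_inner hg hf
  rw [flip_innerₗ] at h
  rw [Real.fourierInv_eq]
  calc ∫ ξ, Real.fourierChar (inner ℝ ξ x) • (m ξ • 𝓕 f ξ) = ∫ ξ, g ξ • 𝓕 f ξ := by
        simp only [g, smul_assoc]
    _ = ∫ y, 𝓕 g y • f y := h.symm
    _ = ∫ y, 𝓕 m (y - x) • f y := by simp only [hgF]
    _ = ∫ z, 𝓕 m z • f (x + z) := by
        rw [← integral_add_left_eq_self _ x]
        simp

/-- A symbol vanishing at 0 has a kernel of mean zero, so `f (x + z)` may be replaced by `f (x + z)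
- f x` in the convolution, and the Hölder bound applies under the integral. -/
theorem norm_fourierInv_smul_fourier_le {m : 𝓢(RSpace n, ℂ)} (hm0 : m 0 = 0) {f : RSpace n → F}
    (hf : Integrable f) {A B s : ℝ} (hA : ∀ x y, ‖f x - f y‖ ≤ A * ‖x - y‖ ^ s)
    (hi : Integrable fun z => ‖𝓕 m z‖ * ‖z‖ ^ s) (hB : ∫ z, ‖𝓕 m z‖ * ‖z‖ ^ s ≤ B)
    (hA0 : 0 ≤ A) (x : RSpace n) :
    ‖𝓕⁻ (fun ξ => m ξ • 𝓕 f ξ) x‖ ≤ A * B := by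
  have hint : Integrable (𝓕 m : 𝓢(RSpace n, ℂ)) volume := (𝓕 m).integrable
  have h0 : ∫ z, 𝓕 m z = 0 := by
    have := fourierInv_fourier_eq (F := 𝓢(RSpace n, ℂ)) m
    rw [← hm0]
    conv_rhs => rw [← this, SchwartzMap.fourierInv_coe, Real.fourierInv_eq]
    simp
  have hfx : Integrable (fun z => 𝓕 m z • f (x + z)) := by
    have h1 : Integrable (fun z => f (x + z)) := hf.comp_add_left x
    exact h1.bdd_smul _ (𝓕 m).continuous.aestronglyMeasurable
      (.of_forall fun ξ => SchwartzMap.norm_le_seminorm ℝ (𝓕 m) ξ)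
  have h1 : 𝓕⁻ (fun ξ => m ξ • 𝓕 f ξ) x = ∫ z, 𝓕 m z • (f (x + z) - f x) := by
    simp only [smul_sub]
    rw [fourierInv_smul_fourier m.integrable hf, ← SchwartzMap.fourier_coe,
      integral_sub hfx (hint.smul_const _), integral_smul_const, h0, zero_smul, sub_zero]
  rw [h1]
  calc ‖∫ z, 𝓕 m z • (f (x + z) - f x)‖ ≤ ∫ z, A * (‖𝓕 m z‖ * ‖z‖ ^ s) := by
        refine norm_integral_le_of_norm_le (hi.const_mul A) (.of_forall fun z => ?_)
        rw [norm_smul]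
        have := hA (x + z) x
        rw [add_sub_cancel_left] at this
        calc _ ≤ ‖𝓕 m z‖ * (A * ‖z‖ ^ s) := by gcongr
          _ = _ := by ring
    _ ≤ A * B := by
        rw [integral_const_mul]; gcongr

end Kernel

theorem fourier_comp_smul {n : ℕ} (f : RSpace n → ℂ) {a : ℝ} (ha : 0 < a) (z : RSpace n) :
    𝓕 (fun ξ => f (a • ξ)) z = ((a ^ n)⁻¹ : ℝ) • 𝓕 f (a⁻¹ • z) := by
  rw [Real.fourier_eq, Real.fourier_eq]
  have := Measure.integral_comp_smul (volume : Measure (RSpace n))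
    (fun ξ => Real.fourierChar (-inner ℝ ξ (a⁻¹ • z)) • f ξ) a
  rw [finrank_euclideanSpace_fin, abs_of_pos (by positivity)] at this
  rw [← this]
  refine integral_congr_ae (.of_forall fun ξ => ?_)
  simp only [inner_smul_left, inner_smul_right]
  simp [ha.ne']

theorem integral_norm_fourier_comp_smul {n : ℕ} (f : RSpace n → ℂ) {a : ℝ} (ha : 0 < a) (s : ℝ) :
    ∫ z, ‖𝓕 (fun ξ => f (a • ξ)) z‖ * ‖z‖ ^ s = a ^ s * ∫ z, ‖𝓕 f z‖ * ‖z‖ ^ s := by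
  have := Measure.integral_comp_smul (volume : Measure (RSpace n))
    (fun z => ‖𝓕 f z‖ * ‖a • z‖ ^ s) a⁻¹
  rw [finrank_euclideanSpace_fin, abs_of_pos (by positivity)] at this
  simp only [fourier_comp_smul f ha, norm_smul, Real.norm_eq_abs, abs_inv, abs_of_pos ha, mul_assoc,
    abs_pow, integral_const_mul] at this ⊢
  simp only [mul_inv_cancel_left₀ ha.ne'] at this
  rw [this, smul_eq_mul, inv_pow, inv_inv, inv_mul_cancel_left₀ (by positivity),
    ← integral_const_mul]
  refine integral_congr_ae (.of_forall fun z => ?_)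
  simp only
  rw [Real.mul_rpow ha.le (norm_nonneg _)]; ring

/-- The homogeneous Besov norm is controlled by the homogeneous Hölder seminorm. -/
theorem besovNorm_le_of_holder {n : ℕ} {φ : RSpace n → ℝ} (hφ : IsLPCutoff φ) :
    ∃ C : ℝ, 0 ≤ C ∧ ∀ (u : 𝓢(RSpace n, RSpace n)) (A : ℝ), 0 ≤ A →
      (∀ x y, ‖u x - u y‖ ≤ A * ‖x - y‖ ^ (1 / 2 : ℝ)) →
      besovNorm φ (1 / 2) u ≤ ENNReal.ofReal (C * A) := by
  let m : RSpace n → ℝ := fun ξ => φ ξ - φ ((2 : ℝ) • ξ)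
  have hm : ContDiff ℝ ∞ m := hφ.smooth.sub (hφ.smooth.comp (contDiff_const_smul 2))
  have hm0 : ∀ ξ, 7 / 6 < ‖ξ‖ → m ξ = 0 := fun ξ hξ => by
    simp only [m]
    rw [hφ.eq_zero ξ hξ, hφ.eq_zero, sub_zero]
    rw [norm_smul]; norm_num; linarith
  have hS : ∀ a : ℝ, 0 < a → ∃ S : 𝓢(RSpace n, ℂ), ∀ ξ, S ξ = m (a • ξ) := by
    intro a ha
    have h2 : ContDiff ℝ ∞ (fun ξ => Complex.ofRealCLM (m (a • ξ))) :=
      Complex.ofRealCLM.contDiff.comp (hm.comp (contDiff_const_smul a))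
    have h1 : HasCompactSupport (fun ξ => Complex.ofRealCLM (m (a • ξ))) := by
      refine HasCompactSupport.of_support_subset_isCompact
        (isCompact_closedBall (0 : RSpace n) (7 / 6 / a)) fun ξ hξ => ?_
      rw [mem_closedBall_zero_iff]
      by_contra hlt
      push Not at hlt
      refine hξ ?_
      simp only
      rw [hm0, map_zero]
      rw [norm_smul, Real.norm_eq_abs, abs_of_pos ha]
      rwa [div_lt_iff₀' ha] at hlt
    exact ⟨h1.toSchwartzMap h2, fun ξ => rfl⟩
  choose! S hS using hS
  have hcoe : ∀ a : ℝ, 0 < a → (S a : RSpace n → ℂ) = fun ξ => S 1 (a • ξ) := fun a ha => by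
    funext ξ
    rw [hS a ha, hS 1 one_pos, one_smul]
  have hi : ∀ a : ℝ, Integrable fun z => ‖𝓕 (S a) z‖ * ‖z‖ ^ (1 / 2 : ℝ) := by
    intro a
    have h0 := ((𝓕 (S a)).integrable (μ := volume)).norm
    have h1 := (𝓕 (S a)).integrable_pow_mul volume 1
    refine (h0.add h1).mono' ?_ (.of_forall fun z => ?_)
    · refine ((𝓕 (S a)).continuous.norm.mul ?_).aestronglyMeasurable
      exact (Real.continuous_rpow_const (by norm_num)).comp continuous_norm
    · rw [Real.norm_of_nonneg (by positivity)]
      simp only [Pi.add_apply, pow_one]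
      have : ‖z‖ ^ (1 / 2 : ℝ) ≤ 1 + ‖z‖ := by
        rw [← Real.sqrt_eq_rpow, Real.sqrt_le_left (by positivity)]
        nlinarith [norm_nonneg z]
      nlinarith [norm_nonneg (𝓕 (S a) z)]
  let B := ∫ z, ‖𝓕 (S 1) z‖ * ‖z‖ ^ (1 / 2 : ℝ)
  have hB : 0 ≤ B := integral_nonneg fun z => by positivity
  -- Dilating the symbol by a = 2^{-j}·2π multiplies the kernel's moment `B` of order 1/2 by
  -- a^{1/2}; the Besov weight 2^{j/2} removes the dependence on j and leaves (2π)^{1/2} B.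
  refine ⟨(2 * Real.pi) ^ (1 / 2 : ℝ) * B, by positivity, fun u A hA0 hA => iSup_le fun j => ?_⟩
  set a : ℝ := (2 : ℝ) ^ (-j) * (2 * Real.pi) with ha
  have hapos : 0 < a := by positivity
  have hbound : ∀ x, ‖lpProj φ j u x‖ ≤ A * (a ^ (1 / 2 : ℝ) * B) := by
    intro x
    have hlp : lpProj φ j u x = 𝓕⁻ (fun ξ => S a ξ • 𝓕 (complexify u) ξ) x := by
      unfold lpProj
      refine congrArg (fun f : RSpace n → EuclideanSpace ℂ (Fin n) => 𝓕⁻ f x) (funext fun ξ => ?_)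
      rw [hS a hapos, Complex.coe_smul, ← ha]
      simp only [m, smul_smul]
    rw [hlp]
    refine norm_fourierInv_smul_fourier_le ?_ (integrable_complexify u.integrable) (s := 1 / 2)
      (fun x y => ?_) (hi a) (le_of_eq ?_) hA0 x
    · rw [hS a hapos]
      simp [m]
    · rw [norm_complexify]; exact hA x y
    · simp only [SchwartzMap.fourier_coe, hcoe a hapos, B]
      exact integral_norm_fourier_comp_smul _ hapos _
  have h2 : eLpNorm (lpProj φ j u) ∞ volume ≤ ENNReal.ofReal (A * (a ^ (1 / 2 : ℝ) * B)) := by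
    rw [eLpNorm_exponent_top]
    exact eLpNormEssSup_le_of_ae_bound (.of_forall hbound)
  refine (mul_le_mul_right h2 _).trans ?_
  rw [← ENNReal.ofReal_mul (by positivity)]
  refine ENNReal.ofReal_le_ofReal (le_of_eq ?_)
  rw [ha, Real.mul_rpow (by positivity) (by positivity), ← Real.rpow_intCast, ← Real.rpow_mul
    (by norm_num)]
  have : (2 : ℝ) ^ ((j : ℝ) * (1 / 2)) * (2 : ℝ) ^ (((-j : ℤ) : ℝ) * (1 / 2)) = 1 := by
    rw [← Real.rpow_add (by norm_num)]
    push_cast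
    rw [show (j : ℝ) * (1 / 2) + -j * (1 / 2) = 0 by ring, Real.rpow_zero]
  linear_combination (A * (2 * Real.pi) ^ (1 / 2 : ℝ) * B) * this

/-! ### The smoothed dipole kernel -/

/-- A smooth cut-off of the power `s ^ (-n / 2)`. -/
theorem exists_cutoff_rpow (n : ℕ) : ∃ g : ℝ → ℝ, ContDiff ℝ ∞ g ∧ (∀ s ≤ 25 / 64, g s = 0) ∧
    ∀ s, 9 / 16 ≤ s → g s = s ^ (-(n : ℝ) / 2) := by
  -- With s = |x|² the thresholds 25/64 and 9/16 are the radii 5/8 and 3/4; 11/64 is their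
  -- difference.
  refine ⟨fun s => Real.smoothTransition ((s - 25 / 64) / (11 / 64)) * s ^ (-(n : ℝ) / 2),
    ?_, fun s hs => ?_, fun s hs => ?_⟩
  · rw [contDiff_iff_contDiffAt]
    intro s
    rcases lt_or_ge s (25 / 64) with hs | hs
    · refine contDiffAt_const (c := (0 : ℝ)) |>.congr_of_eventuallyEq ?_
      filter_upwards [Iio_mem_nhds hs] with t ht
      rw [Real.smoothTransition.zero_of_nonpos, zero_mul]
      have : t < 25 / 64 := ht
      apply div_nonpos_of_nonpos_of_nonneg <;> linarith
    · have h1 : ContDiff ℝ ∞ fun s : ℝ => Real.smoothTransition ((s - 25 / 64) / (11 / 64)) :=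
        Real.smoothTransition.contDiff.comp (by fun_prop)
      exact h1.contDiffAt.mul (Real.contDiffAt_rpow_const_of_ne (by linarith))
  · simp only
    rw [Real.smoothTransition.zero_of_nonpos, zero_mul]
    apply div_nonpos_of_nonpos_of_nonneg <;> linarith
  · simp only
    rw [Real.smoothTransition.one_of_one_le, one_mul]
    rw [le_div_iff₀ (by norm_num)]; linarith

section Radial

variable {n : ℕ} {g : ℝ → ℝ}

theorem hasFDerivAt_comp_norm_sq (hg : Differentiable ℝ g) (x : RSpace n) :
    HasFDerivAt (fun y => g (‖y‖ ^ 2)) (deriv g (‖x‖ ^ 2) • (2 • innerSL ℝ x)) x :=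
  (hg _).hasDerivAt.comp_hasFDerivAt x (hasStrictFDerivAt_norm_sq x).hasFDerivAt

theorem hasFDerivAt_coord (i : Fin n) (x : RSpace n) :
    HasFDerivAt (fun y : RSpace n => y i) (EuclideanSpace.proj (𝕜 := ℝ) i) x :=
  (EuclideanSpace.proj (𝕜 := ℝ) i).hasFDerivAt

theorem contDiff_comp_norm_sq (hg : ContDiff ℝ ∞ g) :
    ContDiff ℝ ∞ (fun y : RSpace n => g (‖y‖ ^ 2)) :=
  hg.comp (contDiff_norm_sq ℝ)

theorem contDiff_coord (i : Fin n) : ContDiff ℝ ∞ (fun y : RSpace n => y i) :=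
  (EuclideanSpace.proj (𝕜 := ℝ) i).contDiff

theorem fderiv_coord_mul_radial (hg : ContDiff ℝ ∞ g) (i : Fin n) (x w : RSpace n) :
    fderiv ℝ (fun y : RSpace n => y i * g (‖y‖ ^ 2)) x w =
      w i * g (‖x‖ ^ 2) + x i * (deriv g (‖x‖ ^ 2) * (2 * inner ℝ x w)) := by
  rw [((hasFDerivAt_coord i x).fun_mul
    (hasFDerivAt_comp_norm_sq (hg.differentiable (by simp)) x)).fderiv]
  simp
  ring

theorem hess_coord_mul_radial (hg : ContDiff ℝ ∞ g) (i : Fin n) (x v w : RSpace n) :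
    hess (fun y : RSpace n => y i * g (‖y‖ ^ 2)) x v w =
      2 * deriv g (‖x‖ ^ 2) * (w i * inner ℝ x v + v i * inner ℝ x w + x i * inner ℝ v w)
      + 4 * deriv (deriv g) (‖x‖ ^ 2) * x i * inner ℝ x v * inner ℝ x w := by
  have hk : ContDiff ℝ ∞ (fun y : RSpace n => y i * g (‖y‖ ^ 2)) :=
    (contDiff_coord i).mul (contDiff_comp_norm_sq hg)
  have h2 : ContDiff ℝ ∞ (fderiv ℝ (fun y : RSpace n => y i * g (‖y‖ ^ 2))) :=
    hk.fderiv_right (by simp)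
  have hg' : ContDiff ℝ ∞ (deriv g) := (contDiff_infty_iff_deriv.1 hg).2
  have h3 : hess (fun y : RSpace n => y i * g (‖y‖ ^ 2)) x v w
      = fderiv ℝ (fun y => fderiv ℝ (fun y : RSpace n => y i * g (‖y‖ ^ 2)) y w) x v := by
    rw [fderiv_clm_apply (h2.differentiable (by simp)).differentiableAt (differentiableAt_const w)]
    simp
  rw [h3]
  simp only [fderiv_coord_mul_radial hg]
  have hin : HasFDerivAt (fun y : RSpace n => 2 * inner ℝ y w) ((2 : ℝ) • innerSL ℝ w) x := by
    have := ((innerSL ℝ w).hasFDerivAt (x := x)).const_mul (2 : ℝ)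
    simpa [real_inner_comm] using this
  rw [(((hasFDerivAt_comp_norm_sq (hg.differentiable (by simp)) x).const_mul (w i)).fun_add
    ((hasFDerivAt_coord i x).fun_mul ((hasFDerivAt_comp_norm_sq
      (hg'.differentiable (by simp)) x).fun_mul hin))).fderiv]
  simp [real_inner_comm w v]
  ring

/-- With s = |x|², both sides equal x_i (4 s g'' + (2n + 4) g'). The right side exhibits the
Laplacian as an exact i-th derivative. -/
theorem sum_hess_coord_mul_radial (hg : ContDiff ℝ ∞ g) (i : Fin n) (x : RSpace n) :
    ∑ a, hess (fun y : RSpace n => y i * g (‖y‖ ^ 2)) x (stdVec a) (stdVec a) =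
      fderiv ℝ (fun y : RSpace n => 2 * (‖y‖ ^ 2 * deriv g (‖y‖ ^ 2)) + n * g (‖y‖ ^ 2)) x
        (stdVec i) := by
  have hg' : ContDiff ℝ ∞ (deriv g) := (contDiff_infty_iff_deriv.1 hg).2
  have h1 := hasFDerivAt_comp_norm_sq (n := n) (hg.differentiable (by simp)) x
  have h2 := hasFDerivAt_comp_norm_sq (n := n) (hg'.differentiable (by simp)) x
  have h3 := hasFDerivAt_comp_norm_sq (n := n) (g := fun s => s) differentiable_id x
  rw [(((h3.fun_mul h2).const_mul 2).fun_add (h1.const_mul (n : ℝ))).fderiv]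
  simp only [hess_coord_mul_radial hg]
  have hs : ‖x‖ ^ 2 = ∑ a, x a ^ 2 := EuclideanSpace.real_norm_sq_eq x
  have e1 : ∀ a, 2 * deriv g (‖x‖ ^ 2) * ((stdVec a : RSpace n) i * inner ℝ x (stdVec a) +
      (stdVec a : RSpace n) i * inner ℝ x (stdVec a) +
      x i * inner ℝ (stdVec a : RSpace n) (stdVec a))
      + 4 * deriv (deriv g) (‖x‖ ^ 2) * x i * inner ℝ x (stdVec a) * inner ℝ x (stdVec a)
      = (if i = a then 4 * deriv g (‖x‖ ^ 2) * x a else 0) + 2 * deriv g (‖x‖ ^ 2) * x i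
        + 4 * deriv (deriv g) (‖x‖ ^ 2) * x i * x a ^ 2 := by
    intro a
    simp [EuclideanSpace.inner_single_right]
    split_ifs <;> ring
  simp only [e1, Finset.sum_add_distrib, ← Finset.mul_sum, ← hs]
  simp [EuclideanSpace.inner_single_right]
  ring

end Radial

/-- A smooth function equal to `x_i / ‖x‖ⁿ` away from the origin, whose Laplacian is the
`i`-th derivative of a compactly supported function. -/
theorem exists_dipole (n : ℕ) (hn : 2 ≤ n) (i : Fin n) : ∃ k K : RSpace n → ℝ,
    ContDiff ℝ ∞ k ∧ ContDiff ℝ ∞ K ∧ (∀ x, 3 / 4 < ‖x‖ → K x = 0) ∧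
    (∀ x, ∑ a, hess k x (stdVec a) (stdVec a) = fderiv ℝ K x (stdVec i)) ∧
    (∀ x, ‖x‖ ≤ 5 / 8 → k x = 0) ∧
    (∀ (c : ℝ) x, 1 ≤ c → 3 / 4 ≤ ‖x‖ → c ^ n / c * k (c • x) = k x) ∧
    0 < hess k (stdVec i) (stdVec i) (stdVec i) := by
  obtain ⟨g, hg, hg0, hg1⟩ := exists_cutoff_rpow n
  have hg' : ContDiff ℝ ∞ (deriv g) := (contDiff_infty_iff_deriv.1 hg).2
  have hd : ∀ s, 9 / 16 < s → deriv g s = -(n : ℝ) / 2 * s ^ (-(n : ℝ) / 2 - 1) := by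
    intro s hs
    have : g =ᶠ[nhds s] fun t => t ^ (-(n : ℝ) / 2) := by
      filter_upwards [Ioi_mem_nhds hs] with t ht using hg1 t (le_of_lt ht)
    rw [this.deriv_eq, Real.deriv_rpow_const]
  refine ⟨fun y => y i * g (‖y‖ ^ 2),
    fun y => 2 * (‖y‖ ^ 2 * deriv g (‖y‖ ^ 2)) + n * g (‖y‖ ^ 2),
    (contDiff_coord i).mul (contDiff_comp_norm_sq hg), ?_, fun x hx => ?_,
    sum_hess_coord_mul_radial hg i, fun x hx => ?_, fun c x hc hx => ?_, ?_⟩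
  · have := contDiff_comp_norm_sq (n := n) hg
    have := contDiff_comp_norm_sq (n := n) hg'
    have := contDiff_norm_sq ℝ (E := RSpace n) (n := ∞)
    fun_prop
  -- Where g is the pure power s^{-n/2}, Euler's relation 2 s g' = -n g makes K vanish; this is
  -- harmonicity of the dipole.
  · have hs : 9 / 16 < ‖x‖ ^ 2 := by nlinarith
    have hs0 : 0 < ‖x‖ ^ 2 := by linarith
    simp only
    rw [hd _ hs, hg1 _ hs.le, Real.rpow_sub_one hs0.ne']
    field_simp
    ring
  · simp only
    rw [hg0, mul_zero]
    nlinarith [norm_nonneg x]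
  · have hs : 9 / 16 ≤ ‖x‖ ^ 2 := by nlinarith
    have hc0 : 0 < c := by linarith
    simp only [norm_smul, Real.norm_eq_abs, abs_of_pos hc0, PiLp.smul_apply, smul_eq_mul, mul_pow]
    have hcs : 9 / 16 ≤ c ^ 2 * ‖x‖ ^ 2 := by nlinarith [sq_nonneg ‖x‖]
    rw [hg1 _ hs, hg1 _ hcs, Real.mul_rpow (by positivity) (by positivity), ← Real.rpow_natCast c 2,
      ← Real.rpow_mul hc0.le]
    have : c ^ n * c ^ (((2 : ℕ) : ℝ) * (-(n : ℝ) / 2)) = 1 := by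
      rw [← Real.rpow_natCast, ← Real.rpow_add hc0]
      push_cast
      rw [show (n : ℝ) + 2 * (-(n : ℝ) / 2) = 0 by ring, Real.rpow_zero]
    generalize c ^ (((2 : ℕ) : ℝ) * (-(n : ℝ) / 2)) = A at this ⊢
    field_simp
    linear_combination (x i) * this
  -- The value is 6 g'(1) + 4 g''(1) = n(n - 1), the second derivative of t^{1-n} at t = 1.
  · rw [hess_coord_mul_radial hg]
    have hdd : deriv (deriv g) 1 = -(n : ℝ) / 2 * (-(n : ℝ) / 2 - 1) := by
      have : deriv g =ᶠ[nhds 1] fun t => -(n : ℝ) / 2 * t ^ (-(n : ℝ) / 2 - 1) := by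
        filter_upwards [Ioi_mem_nhds (show (9 / 16 : ℝ) < 1 by norm_num)] with t ht using hd t ht
      rw [this.deriv_eq, deriv_const_mul_field, Real.deriv_rpow_const]
      simp
    have hn' : (2 : ℝ) ≤ n := by exact_mod_cast hn
    simp [hdd, hd 1 (by norm_num)]
    nlinarith

/-! ### Differences of dilated dipoles as test functions -/

theorem hess_comp_smul {n : ℕ} {h : RSpace n → ℝ} (c b : ℝ) (x v w : RSpace n)
    (hh : ContDiff ℝ ∞ h) :
    hess (fun y => b * h (c • y)) x v w = b * c ^ 2 * hess h (c • x) v w := by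
  have h1 : fderiv ℝ (fun y => b * h (c • y)) = fun y => (b * c) • fderiv ℝ h (c • y) := by
    funext y
    rw [fderiv_const_mul (by
      exact (hh.differentiable (by simp)).differentiableAt.comp y (by fun_prop)),
      fderiv_comp_smul, smul_smul]
  have h2 : Differentiable ℝ (fderiv ℝ h) :=
    (hh.fderiv_right (m := ∞) (by simp)).differentiable (by simp)
  simp only [hess]
  have h3 : fderiv ℝ (fun y => (b * c) • fderiv ℝ h (c • y)) x
      = (b * c) • fderiv ℝ (fun y => fderiv ℝ h (c • y)) x :=
    fderiv_fun_const_smul ((h2 _).comp x (by fun_prop)) _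
  rw [h1, h3, fderiv_comp_smul]
  simp
  ring

theorem contDiff_hess {n : ℕ} {h : RSpace n → ℝ} (hh : ContDiff ℝ ∞ h) : ContDiff ℝ ∞ (hess h) :=
  (hh.fderiv_right (m := ∞) (by simp)).fderiv_right (by simp)

theorem integrable_hess_apply {n : ℕ} {h : RSpace n → ℝ} (hh : ContDiff ℝ ∞ h)
    {U : RSpace n → RSpace n} (hU : Continuous U) (hc : HasCompactSupport U) :
    Integrable fun x => hess h x (U x) (U x) := by
  refine Continuous.integrable_of_hasCompactSupport ?_ ?_
  · exact ((contDiff_hess hh).continuous.clm_apply hU).clm_apply hU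
  · refine hc.mono' fun x hx => subset_tsupport _ ?_
    intro h0
    exact hx (by simp [h0])

/-- The difference between the dilation of `k` by the factor `c` and `k`. -/
def dilationDiff {n : ℕ} (k : RSpace n → ℝ) (c : ℝ) (x : RSpace n) : ℝ :=
  c ^ n / c * k (c • x) - k x

section Dilation

variable {n : ℕ} {k : RSpace n → ℝ}

theorem contDiff_dilationDiff (hk : ContDiff ℝ ∞ k) (c : ℝ) : ContDiff ℝ ∞ (dilationDiff k c) := by
  unfold dilationDiff
  exact (contDiff_const.mul (hk.comp (contDiff_const_smul c))).sub hk

theorem hess_dilationDiff (hk : ContDiff ℝ ∞ k) (c : ℝ) (x v w : RSpace n) :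
    hess (dilationDiff k c) x v w = c ^ (n + 1) * hess k (c • x) v w - hess k x v w := by
  have h1 : ContDiff ℝ ∞ fun y : RSpace n => c ^ n / c * k (c • y) :=
    contDiff_const.mul (hk.comp (contDiff_const_smul c))
  have h2 := hess_comp_smul c (c ^ n / c) x v w hk
  have h3 : fderiv ℝ (dilationDiff k c)
      = fun y => fderiv ℝ (fun y => c ^ n / c * k (c • y)) y - fderiv ℝ k y := by
    funext y
    exact fderiv_fun_sub (h1.differentiable (by simp) y) (hk.differentiable (by simp) y)
  have h4 : hess (dilationDiff k c) x
      = hess (fun y => c ^ n / c * k (c • y)) x - hess k x := by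
    simp only [hess]
    rw [h3]
    exact fderiv_fun_sub
      ((h1.fderiv_right (m := ∞) (by simp)).differentiable (by simp) x)
      ((hk.fderiv_right (m := ∞) (by simp)).differentiable (by simp) x)
  rw [h4, sub_apply, sub_apply, h2]
  congr 2
  field_simp
  ring

end Dilation

theorem hasCompactSupport_dilationDiff {n : ℕ} {k : RSpace n → ℝ}
    (hk : ∀ (c : ℝ) x, 1 ≤ c → 3 / 4 ≤ ‖x‖ → c ^ n / c * k (c • x) = k x) {c : ℝ} (hc : 1 ≤ c) :
    HasCompactSupport (dilationDiff k c) := by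
  refine HasCompactSupport.of_support_subset_isCompact (isCompact_closedBall 0 (3 / 4))
    fun x hx => ?_
  rw [mem_closedBall_zero_iff]
  by_contra! h
  exact hx (by simp [dilationDiff, hk c x hc h.le])

/-- The weak equation and one integration by parts turn the integral into ∫ ∂_i f · G with G = c^n
K(c·) - K. Each of the two terms of G has L¹ norm ‖K‖₁, so the bound does not depend on c. As G
lives in |x| ≤ 3/4, only the derivative on the unit ball matters. -/
theorem IsPressure.abs_integral_hess_dilationDiff_le {n : ℕ} {k K : RSpace n → ℝ} {i : Fin n}
    (hk : ContDiff ℝ ∞ k) (hK : ContDiff ℝ ∞ K) (hK0 : ∀ x, 3 / 4 < ‖x‖ → K x = 0)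
    (hkK : ∀ x, ∑ a, hess k x (stdVec a) (stdVec a) = fderiv ℝ K x (stdVec i))
    (hkc : ∀ (c : ℝ) x, 1 ≤ c → 3 / 4 ≤ ‖x‖ → c ^ n / c * k (c • x) = k x)
    {u : RSpace n → RSpace n} {p f : RSpace n → ℝ} (hp : IsPressure u p) (hu : MemLp u 2 volume)
    (hf : ContDiff ℝ 1 f) (hpf : p =ᵐ[volume] f) {M : ℝ}
    (hM : ∀ᵐ x, ‖x‖ ≤ 1 → |fderiv ℝ f x (stdVec i)| ≤ M) {c : ℝ} (hc : 1 ≤ c) :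
    |∫ x, hess (dilationDiff k c) x (u x) (u x)| ≤ 2 * M * ∫ x, |K x| := by
  have hc0 : 0 < c := by linarith
  have hKs : HasCompactSupport K := by
    refine HasCompactSupport.of_support_subset_isCompact (isCompact_closedBall 0 (3 / 4))
      fun x hx => ?_
    rw [mem_closedBall_zero_iff]
    by_contra! h
    exact hx (hK0 x h)
  have hKi : Integrable K := hK.continuous.integrable_of_hasCompactSupport hKs
  let G : RSpace n → ℝ := fun x => c ^ n * K (c • x) - K x
  have hG : ContDiff ℝ ∞ G := (contDiff_const.mul (hK.comp (contDiff_const_smul c))).sub hK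
  have hG0 : ∀ x, 3 / 4 < ‖x‖ → G x = 0 := by
    intro x hx
    simp only [G]
    rw [hK0 x hx, hK0, mul_zero, sub_zero]
    rw [norm_smul, Real.norm_eq_abs, abs_of_pos hc0]
    nlinarith
  have hGs : HasCompactSupport G := by
    refine HasCompactSupport.of_support_subset_isCompact (isCompact_closedBall 0 (3 / 4))
      fun x hx => ?_
    rw [mem_closedBall_zero_iff]
    by_contra! h
    exact hx (hG0 x h)
  have hlap : ∀ x, ∑ a, hess (dilationDiff k c) x (stdVec a) (stdVec a)
      = fderiv ℝ G x (stdVec i) := by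
    intro x
    simp only [hess_dilationDiff hk c, Finset.sum_sub_distrib, ← Finset.mul_sum, hkK]
    have h1 : DifferentiableAt ℝ (fun y : RSpace n => K (c • y)) x :=
      (hK.differentiable (by simp) _).comp x (by fun_prop)
    have h2 : fderiv ℝ G x = c ^ n • fderiv ℝ (fun y => K (c • y)) x - fderiv ℝ K x := by
      rw [← fderiv_const_mul h1]
      exact fderiv_fun_sub (h1.const_mul _) (hK.differentiable (by simp) x)
    rw [h2, fderiv_comp_smul]
    simp
    ring
  have h1 := hp.integral_mul_laplacian hu (contDiff_dilationDiff hk c)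
    (hasCompactSupport_dilationDiff hkc hc)
  simp only [hlap] at h1
  have h2 : ∫ x, p x * fderiv ℝ G x (stdVec i) = ∫ x, f x * fderiv ℝ G x (stdVec i) := by
    refine integral_congr_ae ?_
    filter_upwards [hpf] with x hx
    rw [hx]
  have hfG : Continuous (fderiv ℝ G) := hG.continuous_fderiv (by simp)
  have hff : Continuous (fderiv ℝ f) := hf.continuous_fderiv (by simp)
  have h3 : ∫ x, f x * fderiv ℝ G x (stdVec i) = -∫ x, fderiv ℝ f x (stdVec i) * G x := by
    refine integral_mul_fderiv_eq_neg_fderiv_mul_of_integrable ?_ ?_ ?_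
      (fun x _ => hf.differentiable (by simp) x) (fun x _ => hG.differentiable (by simp) x)
    · exact ((hff.clm_apply continuous_const).mul hG.continuous).integrable_of_hasCompactSupport
        hGs.mul_left
    · refine (hf.continuous.mul (hfG.clm_apply continuous_const)).integrable_of_hasCompactSupport
        (HasCompactSupport.mul_left ?_)
      exact (hGs.fderiv ℝ).comp_left (g := fun L : RSpace n →L[ℝ] ℝ => L (stdVec i)) (by simp)
    · exact (hf.continuous.mul hG.continuous).integrable_of_hasCompactSupport hGs.mul_left
  have h4 : ∫ x, hess (dilationDiff k c) x (u x) (u x) = ∫ x, fderiv ℝ f x (stdVec i) * G x := by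
    linarith
  have hKci : Integrable fun x : RSpace n => K (c • x) := hKi.comp_smul hc0.ne'
  rw [h4, ← Real.norm_eq_abs]
  have hscale : ∫ x : RSpace n, c ^ n * |K (c • x)| = ∫ x, |K x| := by
    rw [integral_const_mul, Measure.integral_comp_smul volume (fun x => |K x|),
      finrank_euclideanSpace_fin, abs_of_pos (by positivity), smul_eq_mul,
      mul_inv_cancel_left₀ (by positivity)]
  calc ‖∫ x, fderiv ℝ f x (stdVec i) * G x‖
      ≤ ∫ x, M * (c ^ n * |K (c • x)| + |K x|) := by
        refine norm_integral_le_of_norm_le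
          (((hKci.abs.const_mul _).add hKi.abs).const_mul M) ?_
        filter_upwards [hM] with x hx
        rw [norm_mul, Real.norm_eq_abs, Real.norm_eq_abs]
        have hGle : |G x| ≤ c ^ n * |K (c • x)| + |K x| := by
          refine (abs_sub _ _).trans ?_
          rw [abs_mul, abs_of_pos (by positivity)]
        by_cases hx1 : ‖x‖ ≤ 1
        · exact mul_le_mul (hx hx1) hGle (abs_nonneg _) ((abs_nonneg _).trans (hx hx1))
        · have hx2 : 3 / 4 < ‖x‖ := by linarith
          have hx3 : K (c • x) = 0 := hK0 _ (by
            rw [norm_smul, Real.norm_eq_abs, abs_of_pos hc0]; nlinarith)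
          rw [hG0 x hx2, hK0 x hx2, hx3]
          simp
    _ = 2 * M * ∫ x, |K x| := by
        rw [integral_const_mul, integral_add (hKci.abs.const_mul _) hKi.abs, hscale]
        ring

/-! ### The divergence-free profile from a stream function -/

/-- The divergence-free field in the plane of `e_i`, `e_j` with stream function `ψ`. -/
def streamField {n : ℕ} (i j : Fin n) (ψ : RSpace n → ℝ) (x : RSpace n) : RSpace n :=
  fderiv ℝ ψ x (stdVec j) • stdVec i - fderiv ℝ ψ x (stdVec i) • stdVec j

section Stream

variable {n : ℕ} {i j : Fin n} {ψ : RSpace n → ℝ}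

theorem contDiff_streamField (hψ : ContDiff ℝ ∞ ψ) : ContDiff ℝ ∞ (streamField i j ψ) := by
  have h : ContDiff ℝ ∞ (fderiv ℝ ψ) := hψ.fderiv_right (by simp)
  unfold streamField
  fun_prop

theorem tsupport_streamField_subset : tsupport (streamField i j ψ) ⊆ tsupport ψ := by
  refine (closure_minimal (fun x hx => ?_) (isClosed_tsupport _)).trans
    (tsupport_fderiv_subset ℝ (f := ψ))
  refine subset_tsupport _ fun h0 => hx ?_
  simp [streamField, h0]

theorem divergence_streamField (hψ : ContDiff ℝ ∞ ψ) (x : RSpace n) :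
    divergence (streamField i j ψ) x = 0 := by
  have h : ContDiff ℝ ∞ (fderiv ℝ ψ) := hψ.fderiv_right (by simp)
  have hd : DifferentiableAt ℝ (fderiv ℝ ψ) x := h.differentiable (by simp) x
  have h1 : ∀ w : RSpace n, HasFDerivAt (fun y => fderiv ℝ ψ y w)
      ((ContinuousLinearMap.apply ℝ ℝ w).comp (hess ψ x)) x := fun w =>
    (ContinuousLinearMap.apply ℝ ℝ w).hasFDerivAt.comp x hd.hasFDerivAt
  have hsymm : hess ψ x (stdVec i) (stdVec j) = hess ψ x (stdVec j) (stdVec i) :=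
    (hψ.contDiffAt.isSymmSndFDerivAt (by simpa using WithTop.coe_le_coe.2 (le_top : (2 : ℕ∞) ≤ ⊤))) _ _
  have h2 : fderiv ℝ (streamField i j ψ) x = _ :=
    (((h1 (stdVec j)).smul_const (stdVec i)).sub ((h1 (stdVec i)).smul_const (stdVec j))).fderiv
  simp only [divergence, h2]
  simp [Finset.sum_sub_distrib, hsymm]

theorem hess_streamField (k : RSpace n → ℝ) (x : RSpace n) :
    hess k x (streamField i j ψ x) (streamField i j ψ x) =
      fderiv ℝ ψ x (stdVec j) ^ 2 * hess k x (stdVec i) (stdVec i)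
      - fderiv ℝ ψ x (stdVec i) * fderiv ℝ ψ x (stdVec j) *
        (hess k x (stdVec i) (stdVec j) + hess k x (stdVec j) (stdVec i))
      + fderiv ℝ ψ x (stdVec i) ^ 2 * hess k x (stdVec j) (stdVec j) := by
  simp only [streamField, map_sub, map_smul, sub_apply, smul_apply, smul_eq_mul]
  ring

end Stream

/-- Near `stdVec i` the entry D²k(e_i, e_i) is positive. A stream function oscillating fast in x_j
makes the e_i component dominate, so this entry decides the sign. Averaging the phases cos and sin
gives an exact identity in place of an asymptotic estimate. -/
theorem exists_stream_field {n : ℕ} {k : RSpace n → ℝ} (hk : ContDiff ℝ ∞ k) {i j : Fin n}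
    (hij : i ≠ j) (hpos : 0 < hess k (stdVec i) (stdVec i) (stdVec i)) :
    ∃ U : RSpace n → RSpace n, ContDiff ℝ ∞ U ∧
      (∀ x, U x ≠ 0 → 3 / 4 < ‖x‖ ∧ ‖x‖ < 5 / 4) ∧ (∀ x, divergence U x = 0) ∧
      0 < ∫ x, hess k x (U x) (U x) := by
  have hkc : Continuous fun x => hess k x (stdVec i) (stdVec i) :=
    ((contDiff_hess hk).continuous.clm_apply continuous_const).clm_apply continuous_const
  obtain ⟨r, hr, hrpos⟩ := Metric.eventually_nhds_iff.1
    (hkc.continuousAt.eventually (lt_mem_nhds hpos))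
  have hm : 0 < min r (1 / 4) := lt_min hr (by norm_num)
  let χ : ContDiffBump (stdVec i : RSpace n) :=
    ⟨min r (1 / 4) / 4, min r (1 / 4) / 2, by linarith, by linarith⟩
  have hχ : ContDiff ℝ ∞ χ := χ.contDiff
  have hχt : tsupport χ ⊆ Metric.closedBall (stdVec i : RSpace n) (min r (1 / 4) / 2) :=
    χ.tsupport_eq.subset
  let A := ∫ x, χ x ^ 2 * hess k x (stdVec i) (stdVec i)
  have hχ2c : HasCompactSupport fun x => χ x ^ 2 * hess k x (stdVec i) (stdVec i) :=
    HasCompactSupport.mul_right (χ.hasCompactSupport.comp_left (g := fun t => t ^ 2) (by simp))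
  have hA : 0 < A := by
    refine Continuous.integral_pos_of_hasCompactSupport_nonneg_nonzero (x := stdVec i) ?_ hχ2c
      (fun x => ?_) ?_
    · exact (hχ.continuous.pow 2).mul hkc
    · simp only [Pi.zero_apply]
      by_cases hx : χ x = 0
      · simp [hx]
      · have : x ∈ Function.support χ := hx
        rw [χ.support_eq] at this
        have hd : dist x (stdVec i) < r := by
          have h1 : dist x (stdVec i) < min r (1 / 4) / 2 := this
          have := min_le_left r (1 / 4)
          linarith
        have := hrpos hd
        positivity
    · rw [χ.one_of_mem_closedBall (Metric.mem_closedBall_self χ.rIn_pos.le)]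
      simpa using hpos.ne'
  let R := ∫ x, hess k x (streamField i j χ x) (streamField i j χ x)
  -- Then N ≥ 1 and N A = |R| + A, so N² A + R ≥ A > 0.
  let N := |R| / A + 1
  let ψ : (ℝ → ℝ) → RSpace n → ℝ := fun η x => χ x * η (N * x j)
  have hψ : ∀ η, ContDiff ℝ ∞ η → ContDiff ℝ ∞ (ψ η) := fun η hη =>
    hχ.mul (hη.comp (contDiff_const.mul (contDiff_coord j)))
  have hψt : ∀ η, tsupport (ψ η) ⊆ tsupport χ := fun η => tsupport_mul_subset_left
  have hψc : ∀ η, HasCompactSupport (streamField i j (ψ η)) := fun η =>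
    χ.hasCompactSupport.of_isClosed_subset (isClosed_tsupport _)
      (tsupport_streamField_subset.trans (hψt η))
  have hψd : ∀ η, ContDiff ℝ ∞ η → ∀ x w, fderiv ℝ (ψ η) x w =
      fderiv ℝ χ x w * η (N * x j) + χ x * (deriv η (N * x j) * (N * w j)) := by
    intro η hη x w
    have h1 : HasFDerivAt (fun y : RSpace n => η (N * y j))
        (deriv η (N * x j) • (N • EuclideanSpace.proj (𝕜 := ℝ) j)) x :=
      (hη.differentiable (by simp) _).hasDerivAt.comp_hasFDerivAt x
        ((hasFDerivAt_coord j x).const_mul N)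
    rw [((hχ.differentiable (by simp) x).hasFDerivAt.fun_mul h1).fderiv]
    simp
    ring
  -- The terms linear in N carry sin·cos with opposite signs for the two phases and cancel; the
  -- others combine by sin² + cos² = 1.
  have hsum : ∀ x,
      hess k x (streamField i j (ψ Real.cos) x) (streamField i j (ψ Real.cos) x) +
      hess k x (streamField i j (ψ Real.sin) x) (streamField i j (ψ Real.sin) x) =
      N ^ 2 * (χ x ^ 2 * hess k x (stdVec i) (stdVec i)) +
      hess k x (streamField i j χ x) (streamField i j χ x) := by
    intro x
    have hi : (stdVec i : RSpace n) j = 0 := by simp [hij.symm]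
    have hj : (stdVec j : RSpace n) j = 1 := by simp
    simp only [hess_streamField, hψd _ Real.contDiff_cos, hψd _ Real.contDiff_sin, hi, hj,
      Real.deriv_cos, Real.deriv_sin]
    have := Real.sin_sq_add_cos_sq (N * x j)
    generalize Real.sin (N * x j) = s at this ⊢
    generalize Real.cos (N * x j) = t at this ⊢
    generalize hess k x (stdVec i) (stdVec i) = a at this ⊢
    generalize hess k x (stdVec i) (stdVec j) = b at this ⊢
    generalize hess k x (stdVec j) (stdVec i) = c at this ⊢
    generalize hess k x (stdVec j) (stdVec j) = d at this ⊢
    generalize fderiv ℝ χ x (stdVec i) = f at this ⊢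
    generalize fderiv ℝ χ x (stdVec j) = g at this ⊢
    linear_combination (N ^ 2 * χ x ^ 2 * a + g ^ 2 * a - f * g * (b + c) + f ^ 2 * d) * this
  have hint : ∀ η, ContDiff ℝ ∞ η → Integrable fun x =>
      hess k x (streamField i j (ψ η) x) (streamField i j (ψ η) x) := fun η hη =>
    integrable_hess_apply hk (contDiff_streamField (hψ η hη)).continuous (hψc η)
  have hintχ : Integrable fun x => hess k x (streamField i j χ x) (streamField i j χ x) :=
    integrable_hess_apply hk (contDiff_streamField hχ).continuous
      (χ.hasCompactSupport.of_isClosed_subset (isClosed_tsupport _) tsupport_streamField_subset)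
  have hintA : Integrable fun x => χ x ^ 2 * hess k x (stdVec i) (stdVec i) :=
    ((hχ.continuous.pow 2).mul hkc).integrable_of_hasCompactSupport hχ2c
  have htot : (∫ x, hess k x (streamField i j (ψ Real.cos) x) (streamField i j (ψ Real.cos) x)) +
      (∫ x, hess k x (streamField i j (ψ Real.sin) x) (streamField i j (ψ Real.sin) x)) =
      N ^ 2 * A + R := by
    rw [← integral_add (hint _ Real.contDiff_cos) (hint _ Real.contDiff_sin)]
    simp only [hsum]
    rw [integral_add (hintA.const_mul _) hintχ, integral_const_mul]
  have hNA : 0 < N ^ 2 * A + R := by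
    have h1 : N * A = |R| + A := by simp only [N]; field_simp
    have h2 : 1 ≤ N := by simp only [N]; linarith [div_nonneg (abs_nonneg R) hA.le]
    nlinarith [neg_abs_le R, mul_le_mul_of_nonneg_right h2 (mul_nonneg (by linarith) hA.le :
      0 ≤ N * A)]
  have hex : ∃ η, ContDiff ℝ ∞ η ∧
      0 < ∫ x, hess k x (streamField i j (ψ η) x) (streamField i j (ψ η) x) := by
    by_contra! hcon
    linarith [hcon _ Real.contDiff_cos, hcon _ Real.contDiff_sin]
  obtain ⟨η, hη, hηpos⟩ := hex
  refine ⟨streamField i j (ψ η), contDiff_streamField (hψ η hη), fun x hx => ?_,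
    divergence_streamField (hψ η hη), hηpos⟩
  have h1 : x ∈ Metric.closedBall (stdVec i : RSpace n) (min r (1 / 4) / 2) :=
    hχt (hψt η (tsupport_streamField_subset (subset_tsupport _ hx)))
  have h2 : ‖x - stdVec i‖ < 1 / 4 := by
    rw [mem_closedBall_iff_norm] at h1
    have := min_le_right r (1 / 4)
    linarith
  have h3 : ‖(stdVec i : RSpace n)‖ = 1 := by simp
  have h4 := norm_sub_norm_le x (stdVec i)
  have h5 := norm_sub_norm_le (stdVec i) x
  rw [norm_sub_rev] at h5
  constructor <;> linarith

/-! ### The lacunary cascade -/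

/-- The rescaling `2^{-j/2} U(2^j x)` of `U`. -/
def dyadicPiece {n : ℕ} (U : RSpace n → RSpace n) (j : ℕ) (x : RSpace n) : RSpace n :=
  (√2)⁻¹ ^ j • U ((2 : ℝ) ^ j • x)

/-- The superposition of the first `N` rescalings of `U`. -/
def cascade {n : ℕ} (U : RSpace n → RSpace n) (N : ℕ) (x : RSpace n) : RSpace n :=
  ∑ j ∈ Finset.range N, dyadicPiece U j x

/-- The superposition of all the rescalings of `U`. -/
def fullCascade {n : ℕ} (U : RSpace n → RSpace n) (x : RSpace n) : RSpace n :=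
  ∑' j, dyadicPiece U j x

section Cascade

variable {n : ℕ} {U : RSpace n → RSpace n}

theorem norm_two_pow_smul (j : ℕ) (x : RSpace n) : ‖(2 : ℝ) ^ j • x‖ = 2 ^ j * ‖x‖ := by
  rw [norm_smul, norm_pow, Real.norm_ofNat]

theorem inv_sqrt_two_pow_mul_self (j : ℕ) : (√2)⁻¹ ^ j * (√2)⁻¹ ^ j = ((2 : ℝ) ^ j)⁻¹ := by
  rw [← mul_pow, ← mul_inv, Real.mul_self_sqrt (by norm_num), inv_pow]

theorem inv_sqrt_two_pow_le_one (j : ℕ) : (√2)⁻¹ ^ j ≤ 1 := by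
  refine pow_le_one₀ (by positivity) (inv_le_one_of_one_le₀ ?_)
  rw [Real.one_le_sqrt]; norm_num

theorem contDiff_dyadicPiece (hU : ContDiff ℝ ∞ U) (j : ℕ) : ContDiff ℝ ∞ (dyadicPiece U j) :=
  (hU.comp (contDiff_const_smul _)).const_smul _

theorem contDiff_cascade (hU : ContDiff ℝ ∞ U) (N : ℕ) : ContDiff ℝ ∞ (cascade U N) :=
  ContDiff.sum fun j _ => contDiff_dyadicPiece hU j

theorem divergence_cascade (hU : ContDiff ℝ ∞ U) (hdiv : ∀ x, divergence U x = 0) (N : ℕ)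
    (x : RSpace n) : divergence (cascade U N) x = 0 := by
  have h1 : fderiv ℝ (cascade U N) x = ∑ j ∈ Finset.range N, fderiv ℝ (dyadicPiece U j) x :=
    fderiv_fun_sum fun j _ => (contDiff_dyadicPiece hU j).differentiable (by simp) x
  have h2 : ∀ j, fderiv ℝ (dyadicPiece U j) x
      = ((√2)⁻¹ ^ j * 2 ^ j) • fderiv ℝ U ((2 : ℝ) ^ j • x) := by
    intro j
    have : fderiv ℝ (dyadicPiece U j) x
        = (√2)⁻¹ ^ j • fderiv ℝ (fun y => U ((2 : ℝ) ^ j • y)) x :=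
      fderiv_fun_const_smul ((hU.differentiable (by simp) _).comp x (by fun_prop)) _
    rw [this, fderiv_comp_smul, smul_smul]
  simp only [divergence] at hdiv ⊢
  simp only [h1, h2, sum_apply, smul_apply, WithLp.ofLp_sum, WithLp.ofLp_smul, Finset.sum_apply,
    Pi.smul_apply]
  rw [Finset.sum_comm]
  refine Finset.sum_eq_zero fun j _ => ?_
  rw [← Finset.smul_sum, hdiv, smul_zero]

variable (hsupp : ∀ x, U x ≠ 0 → 3 / 4 < ‖x‖ ∧ ‖x‖ < 5 / 4)

section
include hsupp

theorem dyadicPiece_ne_zero {j : ℕ} {x : RSpace n} (h : dyadicPiece U j x ≠ 0) :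
    3 / 4 < 2 ^ j * ‖x‖ ∧ 2 ^ j * ‖x‖ < 5 / 4 := by
  rw [← norm_two_pow_smul]
  exact hsupp _ fun h0 => h (by simp [dyadicPiece, h0])

/-- The annuli 3/4 < 2^j |x| < 5/4 are disjoint because 5/4 < 2 · 3/4. -/
theorem exists_forall_dyadicPiece_eq_zero (x : RSpace n) :
    ∃ j, ∀ i, i ≠ j → dyadicPiece U i x = 0 := by
  have key : ∀ i j, i < j → dyadicPiece U i x ≠ 0 → dyadicPiece U j x ≠ 0 → False := by
    intro i j hij hi hj
    have h1 := (dyadicPiece_ne_zero hsupp hi).1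
    have h2 := (dyadicPiece_ne_zero hsupp hj).2
    have h3 : (2 : ℝ) ^ (i + 1) ≤ 2 ^ j := pow_le_pow_right₀ (by norm_num) hij
    rw [pow_succ] at h3
    nlinarith [norm_nonneg x]
  by_cases h : ∃ j, dyadicPiece U j x ≠ 0
  · obtain ⟨j, hj⟩ := h
    refine ⟨j, fun i hij => ?_⟩
    by_contra hi
    rcases lt_or_gt_of_ne hij with h | h
    · exact key i j h hi hj
    · exact key j i h hj hi
  · push Not at h
    exact ⟨0, fun i _ => h i⟩

theorem cascade_eq_zero {N : ℕ} {x : RSpace n} (hx : 5 / 4 ≤ ‖x‖) : cascade U N x = 0 := by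
  refine Finset.sum_eq_zero fun j _ => ?_
  by_contra h
  have h1 := (dyadicPiece_ne_zero hsupp h).2
  have h2 : (1 : ℝ) ≤ 2 ^ j := one_le_pow₀ (by norm_num)
  nlinarith

theorem hasCompactSupport_cascade (N : ℕ) : HasCompactSupport (cascade U N) := by
  refine HasCompactSupport.of_support_subset_isCompact (isCompact_closedBall 0 (5 / 4))
    fun x hx => ?_
  rw [mem_closedBall_zero_iff]
  by_contra! h
  exact hx (cascade_eq_zero hsupp h.le)

theorem norm_cascade_le {B : ℝ} (hB : ∀ x, ‖U x‖ ≤ B) (N : ℕ) (x : RSpace n) :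
    ‖cascade U N x‖ ≤ B := by
  have hB0 : 0 ≤ B := (norm_nonneg _).trans (hB 0)
  obtain ⟨j, hj⟩ := exists_forall_dyadicPiece_eq_zero hsupp x
  by_cases hN : j ∈ Finset.range N
  · rw [cascade, Finset.sum_eq_single_of_mem j hN fun i _ hij => hj i hij, dyadicPiece, norm_smul,
      Real.norm_of_nonneg (by positivity)]
    exact (mul_le_of_le_one_left (norm_nonneg _) (inv_sqrt_two_pow_le_one j)).trans (hB _)
  · rw [cascade, Finset.sum_eq_zero fun i hi => hj i fun h => hN (h ▸ hi), norm_zero]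
    exact hB0

theorem bilin_cascade (L : RSpace n →L[ℝ] RSpace n →L[ℝ] ℝ) (N : ℕ) (x : RSpace n) :
    L (cascade U N x) (cascade U N x) =
      ∑ j ∈ Finset.range N, L (dyadicPiece U j x) (dyadicPiece U j x) := by
  obtain ⟨j, hj⟩ := exists_forall_dyadicPiece_eq_zero hsupp x
  by_cases hN : j ∈ Finset.range N
  · rw [cascade, Finset.sum_eq_single_of_mem j hN fun i _ hij => hj i hij,
      Finset.sum_eq_single_of_mem j hN fun i _ hij => by simp [hj i hij]]
  · have h0 : ∀ i ∈ Finset.range N, dyadicPiece U i x = 0 := fun i hi => hj i fun h => hN (h ▸ hi)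
    rw [cascade, Finset.sum_eq_zero h0, Finset.sum_eq_zero fun i hi => by simp [h0 i hi]]
    simp

/-- The amplitude 2^{-j/2} exactly compensates the dilation 2^j under the square root, so every
piece has Hölder constant `D`. At most two indices are active at the pair x, y, whence 2D uniformly
in `N`. -/
theorem norm_cascade_sub_le {D : ℝ} (hD : ∀ x y, ‖U x - U y‖ ≤ D * √‖x - y‖)
    (hD0 : 0 ≤ D) (N : ℕ) (x y : RSpace n) :
    ‖cascade U N x - cascade U N y‖ ≤ 2 * D * √‖x - y‖ := by
  have hpiece : ∀ j, ‖dyadicPiece U j x - dyadicPiece U j y‖ ≤ D * √‖x - y‖ := by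
    intro j
    rw [dyadicPiece, dyadicPiece, ← smul_sub, norm_smul, Real.norm_of_nonneg (by positivity)]
    have h1 := hD ((2 : ℝ) ^ j • x) ((2 : ℝ) ^ j • y)
    rw [← smul_sub, norm_two_pow_smul, Real.sqrt_mul (by positivity)] at h1
    have h2 : √((2 : ℝ) ^ j) = √2 ^ j := by
      rw [Real.sqrt_eq_iff_mul_self_eq (by positivity) (by positivity), ← mul_pow,
        Real.mul_self_sqrt (by norm_num)]
    have h3 : (√2)⁻¹ ^ j * √2 ^ j = 1 := by
      rw [← mul_pow, inv_mul_cancel₀ (by positivity), one_pow]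
    calc _ ≤ (√2)⁻¹ ^ j * (D * (√((2 : ℝ) ^ j) * √‖x - y‖)) := by gcongr
      _ = (√2)⁻¹ ^ j * √2 ^ j * (D * √‖x - y‖) := by rw [h2]; ring
      _ = _ := by rw [h3, one_mul]
  obtain ⟨a, ha⟩ := exists_forall_dyadicPiece_eq_zero hsupp x
  obtain ⟨b, hb⟩ := exists_forall_dyadicPiece_eq_zero hsupp y
  have h0 : 0 ≤ D * √‖x - y‖ := by positivity
  rw [cascade, cascade, ← Finset.sum_sub_distrib]
  refine (norm_sum_le _ _).trans ?_
  calc ∑ j ∈ Finset.range N, ‖dyadicPiece U j x - dyadicPiece U j y‖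
      ≤ ∑ j ∈ Finset.range N, ((if j = a then D * √‖x - y‖ else 0) +
        (if j = b then D * √‖x - y‖ else 0)) := by
        refine Finset.sum_le_sum fun j _ => ?_
        by_cases hja : j = a
        · rw [if_pos hja]
          have := hpiece j
          split_ifs <;> linarith
        · by_cases hjb : j = b
          · rw [if_pos hjb, if_neg hja]
            have := hpiece j
            linarith
          · simp [ha j hja, hb j hjb, hja, hjb]
    _ ≤ D * √‖x - y‖ + D * √‖x - y‖ := by
        rw [Finset.sum_add_distrib, Finset.sum_ite_eq', Finset.sum_ite_eq']
        split_ifs <;> linarith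
    _ = _ := by ring

/-- A piece with j > J lives in |x| < (5/4) 2^{-j} ≤ (5/8) 2^{-J}, so the series is a finite sum
away from the origin. -/
theorem fullCascade_eq {J N : ℕ} (hN : J + 1 ≤ N) {x : RSpace n} (hx : 5 / 8 ≤ 2 ^ J * ‖x‖) :
    fullCascade U x = cascade U N x := by
  refine tsum_eq_sum fun j hj => ?_
  by_contra h
  have h1 := (dyadicPiece_ne_zero hsupp h).2
  have h2 : J + 1 ≤ j := hN.trans (by simpa using hj)
  have h3 : (2 : ℝ) ^ (J + 1) ≤ 2 ^ j := pow_le_pow_right₀ (by norm_num) h2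
  rw [pow_succ] at h3
  nlinarith [norm_nonneg x]

theorem eventually_fullCascade_eq (x : RSpace n) :
    ∀ᶠ N in Filter.atTop, fullCascade U x = cascade U N x := by
  rcases eq_or_ne x 0 with rfl | hx
  · have h0 : U 0 = 0 := by
      by_contra h
      have := (hsupp 0 h).1
      norm_num at this
    simp [fullCascade, cascade, dyadicPiece, h0]
  · obtain ⟨J, hJ⟩ := pow_unbounded_of_one_lt (5 / 8 / ‖x‖) (one_lt_two (α := ℝ))
    rw [div_lt_iff₀ (norm_pos_iff.2 hx)] at hJ
    filter_upwards [Filter.eventually_ge_atTop (J + 1)] with N hN using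
      fullCascade_eq hsupp hN hJ.le

theorem norm_fullCascade_le {B : ℝ} (hB : ∀ x, ‖U x‖ ≤ B) (x : RSpace n) :
    ‖fullCascade U x‖ ≤ B := by
  obtain ⟨N, hN⟩ := (eventually_fullCascade_eq hsupp x).exists
  rw [hN]
  exact norm_cascade_le hsupp hB N x

theorem norm_fullCascade_sub_le {D : ℝ} (hD : ∀ x y, ‖U x - U y‖ ≤ D * √‖x - y‖)
    (hD0 : 0 ≤ D) (x y : RSpace n) :
    ‖fullCascade U x - fullCascade U y‖ ≤ 2 * D * √‖x - y‖ := by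
  obtain ⟨N, hx, hy⟩ :=
    ((eventually_fullCascade_eq hsupp x).and (eventually_fullCascade_eq hsupp y)).exists
  rw [hx, hy]
  exact norm_cascade_sub_le hsupp hD hD0 N x y

theorem hasCompactSupport_fullCascade : HasCompactSupport (fullCascade U) := by
  refine HasCompactSupport.of_support_subset_isCompact (isCompact_closedBall 0 (5 / 4))
    fun x hx => ?_
  rw [mem_closedBall_zero_iff]
  by_contra! h
  obtain ⟨N, hN⟩ := (eventually_fullCascade_eq hsupp x).exists
  exact hx (by rw [hN, cascade_eq_zero hsupp h.le])

theorem hasCompactSupport_of_annulus : HasCompactSupport U := by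
  refine HasCompactSupport.of_support_subset_isCompact (isCompact_closedBall 0 (5 / 4))
    fun x hx => ?_
  rw [mem_closedBall_zero_iff]
  exact (hsupp x hx).2.le

end

end Cascade

/-! ### Hölder bound for the profile and weak divergence of the cascade -/

/-- The geometric mean of the bounds 2B (boundedness) and L|x - y| (Lipschitz). -/
theorem exists_norm_sub_le_sqrt {n : ℕ} {U : RSpace n → RSpace n} (hU : ContDiff ℝ ∞ U)
    (hc : HasCompactSupport U) : ∃ D, 0 ≤ D ∧ ∀ x y, ‖U x - U y‖ ≤ D * √‖x - y‖ := by
  obtain ⟨B, hB⟩ := hU.continuous.bounded_above_of_compact_support hc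
  obtain ⟨L, hL⟩ := ContDiff.lipschitzWith_of_hasCompactSupport hc hU (by simp)
  refine ⟨√(2 * B * L), by positivity, fun x y => ?_⟩
  have hB0 : 0 ≤ B := (norm_nonneg _).trans (hB 0)
  have h1 : ‖U x - U y‖ ≤ 2 * B := (norm_sub_le _ _).trans (by linarith [hB x, hB y])
  have h2 : ‖U x - U y‖ ≤ L * ‖x - y‖ := by
    have := hL.dist_le_mul x y
    rwa [dist_eq_norm, dist_eq_norm] at this
  rw [← Real.sqrt_mul (by positivity)]
  refine Real.le_sqrt_of_sq_le ?_
  have h0 := norm_nonneg (U x - U y)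
  calc ‖U x - U y‖ ^ 2 = ‖U x - U y‖ * ‖U x - U y‖ := sq _
    _ ≤ 2 * B * (L * ‖x - y‖) := mul_le_mul h1 h2 h0 (by positivity)
    _ = _ := by ring

theorem weaklyDivFree_of_divergence_eq_zero {n : ℕ} {v : RSpace n → RSpace n}
    (hv : ContDiff ℝ ∞ v) (hc : HasCompactSupport v) (hdiv : ∀ x, divergence v x = 0) :
    WeaklyDivFree v := by
  intro ψ hψ _
  have hvi : ∀ i, ContDiff ℝ ∞ fun x => v x i := fun i => (contDiff_coord i).comp hv
  have hci : ∀ i, HasCompactSupport fun x => v x i := fun i =>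
    hc.comp_left (g := fun w : RSpace n => w i) (by simp)
  have hfv : ∀ i, Continuous fun x => fderiv ℝ (fun y => v y i) x (stdVec i) := fun i =>
    ((hvi i).continuous_fderiv (by simp)).clm_apply continuous_const
  have hfc : ∀ i, HasCompactSupport fun x => fderiv ℝ (fun y => v y i) x (stdVec i) := fun i =>
    ((hci i).fderiv ℝ).comp_left (g := fun L : RSpace n →L[ℝ] ℝ => L (stdVec i)) (by simp)
  have hfψ : ∀ i : Fin n, Continuous fun x => fderiv ℝ ψ x (stdVec i) := fun i =>
    (hψ.continuous_fderiv (by simp)).clm_apply continuous_const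
  have h1 : ∀ x, inner ℝ (v x) (∇ ψ x) = ∑ i, v x i * fderiv ℝ ψ x (stdVec i) := by
    intro x
    rw [real_inner_comm, inner_gradient_left]
    conv_lhs => rw [eq_sum_stdVec (v x)]
    simp
  have hi1 : ∀ i, Integrable fun x => v x i * fderiv ℝ ψ x (stdVec i) := fun i =>
    ((hvi i).continuous.mul (hfψ i)).integrable_of_hasCompactSupport (hci i).mul_right
  have hi2 : ∀ i, Integrable fun x => fderiv ℝ (fun y => v y i) x (stdVec i) * ψ x := fun i =>
    ((hfv i).mul hψ.continuous).integrable_of_hasCompactSupport (hfc i).mul_right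
  have h2 : ∀ i, ∫ x, v x i * fderiv ℝ ψ x (stdVec i)
      = -∫ x, fderiv ℝ (fun y => v y i) x (stdVec i) * ψ x := by
    intro i
    refine integral_mul_fderiv_eq_neg_fderiv_mul_of_integrable (hi2 i) (hi1 i) ?_
      (fun x _ => (hvi i).differentiable (by simp) x) (fun x _ => hψ.differentiable (by simp) x)
    exact ((hvi i).continuous.mul hψ.continuous).integrable_of_hasCompactSupport (hci i).mul_right
  have h3 : ∀ x i, fderiv ℝ (fun y => v y i) x (stdVec i) = (fderiv ℝ v x (stdVec i)) i := by
    intro x i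
    have : HasFDerivAt (fun y => v y i) ((EuclideanSpace.proj (𝕜 := ℝ) i).comp (fderiv ℝ v x)) x :=
      (EuclideanSpace.proj (𝕜 := ℝ) i).hasFDerivAt.comp x
        (hv.differentiable (by simp) x).hasFDerivAt
    rw [this.fderiv]
    rfl
  simp only [h1]
  rw [integral_finsetSum _ fun i _ => hi1 i]
  simp only [h2]
  rw [Finset.sum_neg_distrib, ← integral_finsetSum _ fun i _ => hi2 i]
  simp only [← Finset.sum_mul, h3]
  have h4 : ∀ x, ∑ i, (fderiv ℝ v x (stdVec i)) i = 0 := hdiv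
  simp [h4]

/-- The finite cascades are smooth and divergence-free, share the bound `B`, and are eventually
equal to the full one at each point, so dominated convergence passes to the limit. -/
theorem weaklyDivFree_fullCascade {n : ℕ} {U : RSpace n → RSpace n} (hU : ContDiff ℝ ∞ U)
    (hsupp : ∀ x, U x ≠ 0 → 3 / 4 < ‖x‖ ∧ ‖x‖ < 5 / 4) (hdiv : ∀ x, divergence U x = 0) :
    WeaklyDivFree (fullCascade U) := by
  intro ψ hψ hψc
  obtain ⟨B, hB⟩ := hU.continuous.bounded_above_of_compact_support
    (hasCompactSupport_of_annulus hsupp)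
  have hgrad : Continuous (∇ ψ) :=
    (InnerProductSpace.toDual ℝ (RSpace n)).symm.continuous.comp (hψ.continuous_fderiv (by simp))
  have hgc : HasCompactSupport (∇ ψ) :=
    (hψc.fderiv ℝ).comp_left (g := (InnerProductSpace.toDual ℝ (RSpace n)).symm) (by simp)
  have hzero : ∀ N, ∫ x, inner ℝ (cascade U N x) (∇ ψ x) = 0 := fun N =>
    weaklyDivFree_of_divergence_eq_zero (contDiff_cascade hU N) (hasCompactSupport_cascade hsupp N)
      (divergence_cascade hU hdiv N) ψ hψ hψc
  have hlim := tendsto_integral_of_dominated_convergence (μ := (volume : Measure (RSpace n)))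
    (F := fun N x => inner ℝ (cascade U N x) (∇ ψ x))
    (f := fun x => inner ℝ (fullCascade U x) (∇ ψ x)) (fun x => B * ‖∇ ψ x‖)
    (fun N => ((contDiff_cascade hU N).continuous.inner hgrad).aestronglyMeasurable)
    ((hgrad.norm.integrable_of_hasCompactSupport hgc.norm).const_mul B)
    (fun N => .of_forall fun x => (norm_inner_le_norm _ _).trans
      (mul_le_mul_of_nonneg_right (norm_cascade_le hsupp hB N x) (norm_nonneg _)))
    (.of_forall fun x => tendsto_const_nhds.congr' (by
      filter_upwards [eventually_fullCascade_eq hsupp x] with N hN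
      rw [hN]))
  simp only [hzero] at hlim
  exact tendsto_nhds_unique tendsto_const_nhds hlim |>.symm

/-! ### Each scale contributes the same amount -/

section Pairing

variable {n : ℕ} {k : RSpace n → ℝ} {U : RSpace n → RSpace n}

theorem hess_eq_zero_of_norm_lt (hk0 : ∀ x, ‖x‖ ≤ 5 / 8 → k x = 0) {x : RSpace n}
    (hx : ‖x‖ < 5 / 8) : hess k x = 0 := by
  have h1 : ∀ y : RSpace n, ‖y‖ < 5 / 8 → fderiv ℝ k y = 0 := by
    intro y hy
    have : k =ᶠ[nhds y] fun _ => 0 := by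
      filter_upwards [continuous_norm.continuousAt.eventually (gt_mem_nhds hy)] with z hz
      exact hk0 z hz.le
    rw [this.fderiv_eq, fderiv_fun_const]
    rfl
  have : fderiv ℝ k =ᶠ[nhds x] fun _ => 0 := by
    filter_upwards [continuous_norm.continuousAt.eventually (gt_mem_nhds hx)] with z hz
    exact h1 z hz
  rw [hess, this.fderiv_eq, fderiv_fun_const]
  rfl

/-- Homogeneity of degree 1 - n says that `dilationDiff k c` vanishes on the open set |x| > 3/4;
hence so does its Hessian. -/
theorem pow_mul_hess_smul (hk : ContDiff ℝ ∞ k)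
    (hkc : ∀ (c : ℝ) x, 1 ≤ c → 3 / 4 ≤ ‖x‖ → c ^ n / c * k (c • x) = k x) {c : ℝ} (hc : 1 ≤ c)
    {x : RSpace n} (hx : 3 / 4 < ‖x‖) (v w : RSpace n) :
    c ^ (n + 1) * hess k (c • x) v w = hess k x v w := by
  have h0 : ∀ y : RSpace n, 3 / 4 < ‖y‖ → fderiv ℝ (dilationDiff k c) y = 0 := by
    intro y hy
    have : dilationDiff k c =ᶠ[nhds y] fun _ => 0 := by
      filter_upwards [continuous_norm.continuousAt.eventually (lt_mem_nhds hy)] with z hz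
      rw [dilationDiff, hkc c z hc hz.le, sub_self]
    rw [this.fderiv_eq, fderiv_fun_const]
    rfl
  have h1 : hess (dilationDiff k c) x = 0 := by
    have : fderiv ℝ (dilationDiff k c) =ᶠ[nhds x] fun _ => 0 := by
      filter_upwards [continuous_norm.continuousAt.eventually (lt_mem_nhds hx)] with z hz
      exact h0 z hz
    rw [hess, this.fderiv_eq, fderiv_fun_const]
    rfl
  have h2 := hess_dilationDiff hk c x v w
  rw [h1] at h2
  simp only [zero_apply] at h2
  linarith

variable (hk : ContDiff ℝ ∞ k) (hk0 : ∀ x, ‖x‖ ≤ 5 / 8 → k x = 0)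
  (hkc : ∀ (c : ℝ) x, 1 ≤ c → 3 / 4 ≤ ‖x‖ → c ^ n / c * k (c • x) = k x)
  (hU : ContDiff ℝ ∞ U) (hsupp : ∀ x, U x ≠ 0 → 3 / 4 < ‖x‖ ∧ ‖x‖ < 5 / 4)

section
include hk hk0 hkc hsupp

/-- After y = 2^j x, the dilated half of the kernel becomes D²k(y) by homogeneity with factor
2^{J-j} ≥ 1. The undilated half is evaluated at |2^{-j} y|, which for j ≥ 1 is below 5/8, where k
vanishes. For j = 0 the two halves cancel. -/
theorem integral_hess_dilationDiff_dyadicPiece {j J : ℕ} (hjJ : j ≤ J) :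
    ∫ x, hess (dilationDiff k (2 ^ J)) x (dyadicPiece U j x) (dyadicPiece U j x) =
      if j = 0 then 0 else ∫ x, hess k x (U x) (U x) := by
  let F : RSpace n → ℝ := fun y => ((2 : ℝ) ^ j)⁻¹ *
    hess (dilationDiff k (2 ^ J)) (((2 : ℝ) ^ j)⁻¹ • y) (U y) (U y)
  have h1 : ∀ x, hess (dilationDiff k (2 ^ J)) x (dyadicPiece U j x) (dyadicPiece U j x)
      = F ((2 : ℝ) ^ j • x) := by
    intro x
    simp only [F, dyadicPiece, map_smul, smul_apply, smul_eq_mul]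
    rw [inv_smul_smul₀ (by positivity), ← mul_assoc, inv_sqrt_two_pow_mul_self]
  simp only [h1]
  rw [Measure.integral_comp_smul volume F, finrank_euclideanSpace_fin, abs_of_pos (by positivity),
    smul_eq_mul, ← integral_const_mul]
  have h2 : ∀ y, (((2 : ℝ) ^ j) ^ n)⁻¹ * F y =
      if j = 0 then 0 else hess k y (U y) (U y) := by
    intro y
    by_cases hy : U y = 0
    · simp [F, hy]
    obtain ⟨hy1, hy2⟩ := hsupp y hy
    simp only [F]
    rw [hess_dilationDiff hk, smul_smul]
    have hc : (1 : ℝ) ≤ 2 ^ J * (2 ^ j)⁻¹ := by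
      rw [← div_eq_mul_inv, one_le_div (by positivity)]
      exact pow_le_pow_right₀ (by norm_num) hjJ
    have e1 := pow_mul_hess_smul hk hkc hc hy1 (U y) (U y)
    have e3 : (((2 : ℝ) ^ j) ^ n)⁻¹ * ((2 ^ j)⁻¹ * (((2 : ℝ) ^ J) ^ (n + 1) *
        hess k ((2 ^ J * (2 ^ j)⁻¹ : ℝ) • y) (U y) (U y) - hess k (((2 : ℝ) ^ j)⁻¹ • y) (U y) (U y)))
        = hess k y (U y) (U y)
          - ((2 ^ j)⁻¹ : ℝ) ^ (n + 1) * hess k (((2 : ℝ) ^ j)⁻¹ • y) (U y) (U y) := by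
      rw [← e1, mul_pow, pow_succ (((2 : ℝ) ^ j)⁻¹), inv_pow _ n]
      generalize hess k (((2 : ℝ) ^ j)⁻¹ • y) (U y) (U y) = a
      ring
    rw [e3]
    split_ifs with hj
    · simp [hj]
    · rw [hess_eq_zero_of_norm_lt hk0 (x := ((2 : ℝ) ^ j)⁻¹ • y)]
      · simp
      · rw [norm_smul, norm_inv, norm_pow, Real.norm_ofNat, inv_mul_lt_iff₀ (by positivity)]
        have : (2 : ℝ) ^ 1 ≤ 2 ^ j := pow_le_pow_right₀ (by norm_num) (by omega)
        linarith
  simp only [h2]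
  split_ifs <;> simp

include hU

theorem integral_hess_dilationDiff_cascade (J : ℕ) :
    ∫ x, hess (dilationDiff k (2 ^ J)) x (cascade U (J + 1) x) (cascade U (J + 1) x) =
      J * ∫ x, hess k x (U x) (U x) := by
  have hd : ∀ j, HasCompactSupport (dyadicPiece U j) := fun j => by
    refine HasCompactSupport.of_support_subset_isCompact (isCompact_closedBall 0 (5 / 4))
      fun x hx => ?_
    rw [mem_closedBall_zero_iff]
    have h1 := (dyadicPiece_ne_zero hsupp hx).2
    have h2 : (1 : ℝ) ≤ 2 ^ j := one_le_pow₀ (by norm_num)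
    nlinarith [norm_nonneg x]
  simp only [bilin_cascade hsupp]
  rw [integral_finsetSum _ fun j _ => integrable_hess_apply (contDiff_dilationDiff hk _)
    (contDiff_dyadicPiece hU j).continuous (hd j), Finset.sum_range_succ']
  rw [integral_hess_dilationDiff_dyadicPiece hk hk0 hkc hsupp (Nat.zero_le J), if_pos rfl, add_zero,
    Finset.sum_congr rfl fun j hj => by
      rw [integral_hess_dilationDiff_dyadicPiece hk hk0 hkc hsupp (by simpa using hj),
        if_neg (Nat.succ_ne_zero j)]]
  simp

/-- The test kernel vanishes for 2^J |x| < 5/8 and the cascades agree elsewhere, so pieces beyond j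
= J are not seen. -/
theorem integral_hess_dilationDiff_fullCascade (J : ℕ) :
    ∫ x, hess (dilationDiff k (2 ^ J)) x (fullCascade U x) (fullCascade U x) =
      J * ∫ x, hess k x (U x) (U x) := by
  rw [← integral_hess_dilationDiff_cascade hk hk0 hkc hU hsupp J]
  refine integral_congr_ae (.of_forall fun x => ?_)
  simp only
  by_cases hx : 5 / 8 ≤ 2 ^ J * ‖x‖
  · rw [fullCascade_eq hsupp le_rfl hx]
  · push Not at hx
    have h2 : (1 : ℝ) ≤ 2 ^ J := one_le_pow₀ (by norm_num)
    have hz : ∀ v, hess (dilationDiff k (2 ^ J)) x v v = 0 := by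
      intro v
      rw [hess_dilationDiff hk, hess_eq_zero_of_norm_lt hk0 (x := x) (by nlinarith [norm_nonneg x]),
        hess_eq_zero_of_norm_lt hk0 (by rwa [norm_two_pow_smul])]
      simp
    rw [hz, hz]

end

end Pairing

/-! ### Norm bounds for the cascades and conclusion -/

theorem boundedHolder_fullCascade {n : ℕ} {U : RSpace n → RSpace n} (hU : ContDiff ℝ ∞ U)
    (hsupp : ∀ x, U x ≠ 0 → 3 / 4 < ‖x‖ ∧ ‖x‖ < 5 / 4) :
    BoundedHolder (1 / 2) (fullCascade U) := by
  have hUc := hasCompactSupport_of_annulus hsupp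
  obtain ⟨B, hB⟩ := hU.continuous.bounded_above_of_compact_support hUc
  obtain ⟨D, hD0, hD⟩ := exists_norm_sub_le_sqrt hU hUc
  refine ⟨⟨B, norm_fullCascade_le hsupp hB⟩, (2 * D).toNNReal, fun x y => ?_⟩
  have h := norm_fullCascade_sub_le hsupp hD hD0 x y
  rw [edist_dist, edist_dist, dist_eq_norm, dist_eq_norm,
    ENNReal.ofReal_rpow_of_nonneg (norm_nonneg _) (by positivity),
    ← ENNReal.ofReal.eq_1, ← ENNReal.ofReal_mul (by positivity)]
  refine ENNReal.ofReal_le_ofReal (h.trans_eq ?_)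
  rw [Real.sqrt_eq_rpow]
  norm_num

theorem exists_eLpNorm_cascade_le {n : ℕ} {U : RSpace n → RSpace n} (hU : ContDiff ℝ ∞ U)
    (hsupp : ∀ x, U x ≠ 0 → 3 / 4 < ‖x‖ ∧ ‖x‖ < 5 / 4) :
    ∃ E : ℝ, 0 ≤ E ∧ ∀ N, eLpNorm (cascade U N) 2 volume ≤ ENNReal.ofReal E := by
  obtain ⟨B, hB⟩ := hU.continuous.bounded_above_of_compact_support
    (hasCompactSupport_of_annulus hsupp)
  have hmem : MemLp ((Metric.closedBall (0 : RSpace n) (5 / 4)).indicator fun _ => B) 2 volume :=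
    memLp_indicator_const 2 measurableSet_closedBall B (.inr measure_closedBall_lt_top.ne)
  refine ⟨(eLpNorm ((Metric.closedBall (0 : RSpace n) (5 / 4)).indicator fun _ => B) 2 volume).toReal,
     ENNReal.toReal_nonneg, fun N => ?_⟩
  rw [ENNReal.ofReal_toReal hmem.2.ne]
  refine eLpNorm_mono_real fun x => ?_
  by_cases hx : x ∈ Metric.closedBall (0 : RSpace n) (5 / 4)
  · rw [Set.indicator_of_mem hx]
    exact norm_cascade_le hsupp hB N x
  · rw [Set.indicator_of_notMem hx, cascade_eq_zero hsupp, norm_zero]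
    rw [mem_closedBall_zero_iff] at hx
    linarith

theorem exists_dipole_field (n : ℕ) (hn : 2 ≤ n) :
    ∃ (i : Fin n) (k K : RSpace n → ℝ) (U : RSpace n → RSpace n),
    ContDiff ℝ ∞ k ∧ ContDiff ℝ ∞ K ∧ (∀ x, 3 / 4 < ‖x‖ → K x = 0) ∧
    (∀ x, ∑ a, hess k x (stdVec a) (stdVec a) = fderiv ℝ K x (stdVec i)) ∧
    (∀ x, ‖x‖ ≤ 5 / 8 → k x = 0) ∧
    (∀ (c : ℝ) x, 1 ≤ c → 3 / 4 ≤ ‖x‖ → c ^ n / c * k (c • x) = k x) ∧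
    ContDiff ℝ ∞ U ∧ (∀ x, U x ≠ 0 → 3 / 4 < ‖x‖ ∧ ‖x‖ < 5 / 4) ∧
    (∀ x, divergence U x = 0) ∧ 0 < ∫ x, hess k x (U x) (U x) := by
  let i : Fin n := ⟨0, by omega⟩
  let j : Fin n := ⟨1, by omega⟩
  have hij : i ≠ j := by simp [i, j]
  obtain ⟨k, K, hk, hK, hK0, hkK, hk0, hkc, hpos⟩ := exists_dipole n hn i
  obtain ⟨U, hU, hsupp, hdiv, hQ⟩ := exists_stream_field hk hij hpos
  exact ⟨i, k, K, U, hk, hK, hK0, hkK, hk0, hkc, hU, hsupp, hdiv, hQ⟩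

theorem exists_holder_field_pressure_not_contDiff (n : ℕ) (hn : 2 ≤ n) :
    ∃ u : RSpace n → RSpace n, ∃ p : RSpace n → ℝ,
      BoundedHolder (1 / 2) u ∧ MemLp u 2 volume ∧ WeaklyDivFree u ∧ IsPressure u p ∧
      ¬ ∃ f : RSpace n → ℝ, ContDiff ℝ 1 f ∧ p =ᵐ[volume] f := by
  obtain ⟨i, k, K, U, hk, hK, hK0, hkK, hk0, hkc, hU, hsupp, hdiv, hQ⟩ := exists_dipole_field n hn
  have hH := boundedHolder_fullCascade hU hsupp
  have hcont : Continuous (fullCascade U) := by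
    obtain ⟨C, hC⟩ := hH.2
    exact hC.continuous (by norm_num)
  have hmem : MemLp (fullCascade U) 2 volume :=
    hcont.memLp_of_hasCompactSupport (hasCompactSupport_fullCascade hsupp)
  obtain ⟨M, hM⟩ := hH.1
  obtain ⟨p, hp⟩ := exists_isPressure hmem hM
  refine ⟨fullCascade U, p, hH, hmem, weaklyDivFree_fullCascade hU hsupp hdiv, hp, ?_⟩
  rintro ⟨f, hf, hpf⟩
  have hfc : Continuous fun x => fderiv ℝ f x (stdVec i) :=
    (hf.continuous_fderiv (by simp)).clm_apply continuous_const
  -- A C¹ representative has a bounded derivative on the unit ball, contradicting the growth J·Q.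
  obtain ⟨M', hM'⟩ := (isCompact_closedBall (0 : RSpace n) 1).exists_bound_of_continuousOn
    hfc.continuousOn
  have key : ∀ J : ℕ, J * ∫ x, hess k x (U x) (U x) ≤ 2 * M' * ∫ x, |K x| := by
    intro J
    have := hp.abs_integral_hess_dilationDiff_le hk hK hK0 hkK hkc hmem hf hpf (M := M')
      (.of_forall fun x hx => hM' x (by rwa [mem_closedBall_zero_iff]))
      (one_le_pow₀ one_le_two : (1 : ℝ) ≤ 2 ^ J)
    rw [integral_hess_dilationDiff_fullCascade hk hk0 hkc hU hsupp] at this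
    exact (le_abs_self _).trans this
  obtain ⟨J, hJ⟩ := exists_nat_gt ((2 * M' * ∫ x, |K x|) / ∫ x, hess k x (U x) (U x))
  rw [div_lt_iff₀ hQ] at hJ
  exact absurd (key J) (not_le.2 hJ)

theorem exists_schwartz_field_pressure_gradient_large (n : ℕ) (hn : 2 ≤ n) (φ : RSpace n → ℝ)
    (hφ : IsLPCutoff φ) (ε : ℝ) (hε : 0 < ε) :
    ∃ u : 𝓢(RSpace n, RSpace n), ∃ p : RSpace n → ℝ,
      (∀ x, divergence u x = 0) ∧
      besovNorm φ (1 / 2) u + eLpNorm u 2 volume ≤ 1 ∧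
      IsPressure u p ∧ ContDiff ℝ ∞ p ∧
      ENNReal.ofReal (1 / ε) < eLpNorm (∇ p) ∞ volume := by
  obtain ⟨i, k, K, U, hk, hK, hK0, hkK, hk0, hkc, hU, hsupp, hdiv, hQ⟩ := exists_dipole_field n hn
  obtain ⟨C, hC0, hC⟩ := besovNorm_le_of_holder hφ
  obtain ⟨D, hD0, hD⟩ := exists_norm_sub_le_sqrt hU (hasCompactSupport_of_annulus hsupp)
  obtain ⟨E, hE0, hE⟩ := exists_eLpNorm_cascade_le hU hsupp
  -- This normalises the sum of the Besov and L² bounds to (2CD + E) t < 1. It does not involve `J`,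
  -- which can therefore be chosen afterwards.
  let t : ℝ := (C * (2 * D) + E + 1)⁻¹
  have hden : 0 < C * (2 * D) + E + 1 := by positivity
  have ht : 0 < t := inv_pos.2 hden
  set Q := ∫ x, hess k x (U x) (U x) with hQdef
  -- The pairing is quadratic in the field, so it equals t² J Q; this `J` makes it exceed the bound
  -- 2 (1/ε) ‖K‖₁ that |∇p| ≤ 1/ε would force.
  obtain ⟨J, hJ⟩ := exists_nat_gt ((2 * (1 / ε) * ∫ x, |K x|) / (t ^ 2 * Q))
  rw [div_lt_iff₀ (by positivity)] at hJ
  let v : RSpace n → RSpace n := fun x => t • cascade U (J + 1) x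
  have hv : ContDiff ℝ ∞ v := (contDiff_cascade hU _).const_smul t
  have hvc : HasCompactSupport v :=
    (hasCompactSupport_cascade hsupp (J + 1)).comp_left (g := fun w => t • w) (by simp)
  obtain ⟨p, hp, hps⟩ := exists_isPressure_contDiff hv hvc
  have hv2 : MemLp v 2 volume := hv.continuous.memLp_of_hasCompactSupport hvc
  let u : 𝓢(RSpace n, RSpace n) := hvc.toSchwartzMap hv
  have huv : (u : RSpace n → RSpace n) = v := rfl
  refine ⟨u, p, fun x => ?_, ?_, hp, hps, ?_⟩
  · have h1 : fderiv ℝ v x = t • fderiv ℝ (cascade U (J + 1)) x :=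
      fderiv_fun_const_smul ((contDiff_cascade hU _).differentiable (by simp) x) _
    have h2 := divergence_cascade hU hdiv (J + 1) x
    simp only [divergence] at h2
    simp only [divergence, huv, h1, smul_apply, PiLp.smul_apply, ← Finset.smul_sum, h2, smul_zero]
  · have hb : besovNorm φ (1 / 2) u ≤ ENNReal.ofReal (C * (t * (2 * D))) := by
      refine hC u _ (by positivity) fun x y => ?_
      rw [huv]
      simp only [v]
      rw [← smul_sub, norm_smul, Real.norm_of_nonneg ht.le, ← Real.sqrt_eq_rpow, mul_assoc]
      exact mul_le_mul_of_nonneg_left (norm_cascade_sub_le hsupp hD hD0 _ x y) ht.le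
    have hl : eLpNorm u 2 volume ≤ ENNReal.ofReal (t * E) := by
      rw [huv, show v = t • cascade U (J + 1) from rfl, eLpNorm_const_smul,
        ENNReal.ofReal_mul ht.le, ← ofReal_norm, Real.norm_of_nonneg ht.le]
      gcongr
      exact hE _
    refine (add_le_add hb hl).trans ?_
    rw [← ENNReal.ofReal_add (by positivity) (by positivity), ENNReal.ofReal_le_one,
      show C * (t * (2 * D)) + t * E = (C * (2 * D) + E) * t by ring]
    simp only [t]
    rw [← div_eq_mul_inv, div_le_one hden]
    linarith
  · by_contra! hle
    have hgrad : ∀ᵐ x, ‖x‖ ≤ 1 → |fderiv ℝ p x (stdVec i)| ≤ 1 / ε := by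
      rw [eLpNorm_exponent_top] at hle
      filter_upwards [enorm_ae_le_eLpNormEssSup (∇ p) volume] with x hx _
      have h1 := hx.trans hle
      rw [← ofReal_norm, ENNReal.ofReal_le_ofReal_iff (by positivity)] at h1
      rw [← inner_gradient_left, ← Real.norm_eq_abs]
      refine (norm_inner_le_norm _ _).trans ?_
      simpa using h1
    have key := hp.abs_integral_hess_dilationDiff_le hk hK hK0 hkK hkc hv2 (hps.of_le (by simp))
      (ae_eq_refl p) hgrad (one_le_pow₀ one_le_two : (1 : ℝ) ≤ 2 ^ J)
    have hval : ∫ x, hess (dilationDiff k (2 ^ J)) x (v x) (v x) = t ^ 2 * (J * Q) := by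
      rw [hQdef, ← integral_hess_dilationDiff_cascade hk hk0 hkc hU hsupp, ← integral_const_mul]
      refine integral_congr_ae (.of_forall fun x => ?_)
      simp only [v, map_smul, smul_apply, smul_eq_mul]
      ring
    rw [hval] at key
    have := (le_abs_self _).trans key
    linarith

theorem theorem1p5 (n : ℕ) (hn : 2 ≤ n) :
    -- a divergence-free field in `C^{1/2} ∩ L²` whose pressure has no `C¹` representative
    (∃ u : RSpace n → RSpace n, ∃ p : RSpace n → ℝ,
      BoundedHolder (1 / 2) u ∧ MemLp u 2 volume ∧ WeaklyDivFree u ∧ IsPressure u p ∧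
      ¬ ∃ f : RSpace n → ℝ, ContDiff ℝ 1 f ∧ p =ᵐ[volume] f) ∧
    -- the quantitative form for Schwartz fields
    (∀ φ : RSpace n → ℝ, IsLPCutoff φ → ∀ ε : ℝ, 0 < ε →
      ∃ u : 𝓢(RSpace n, RSpace n), ∃ p : RSpace n → ℝ,
        (∀ x, divergence u x = 0) ∧
        besovNorm φ (1 / 2) u + eLpNorm u 2 volume ≤ 1 ∧
        IsPressure u p ∧ ContDiff ℝ ∞ p ∧
        ENNReal.ofReal (1 / ε) < eLpNorm (∇ p) ∞ volume) :=
  ⟨exists_holder_field_pressure_not_contDiff n hn,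
    exists_schwartz_field_pressure_gradient_large n hn⟩

end
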